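/- Let $\mathcal X,\mathcal Y,\mathcal Z$ be finite alphabets, $P_{XY}$ a probability distribution on $\mathcal X\times\mathcal Y$, and $d:\mathcal X\times\mathcal Y\times\mathcal Z\to[0,\infty)$ a distortion measure. Logarithms are to base $2$, $|a|^+=\max(a,0)$, and $(X^n,Y^n)$ is i.i.d. with law $P_{XY}$. A code $\Phi_n$ of length $n$ consists of a finite message set $\mathcal M$, an encoder $\varphi:\mathcal X^n\to\mathcal M$ and a decoder $\psi:\mathcal M\times\mathcal Y^n\to\mathcal Z^n$. For $D\ge 0$, its non-excess-distortion probability is $$\mathrm P_{\mathrm c}(\Phi_n)=1-\Pr\Big(\tfrac1n\sum_{j=1}^n d(X_j,Y_j,Z_j)>D\Big),\qquad Z^n=\psi(\varphi(X^n),Y^n).$$ For $R\ge 0$ let $F^{(n)}(R,D)=\min_{\Phi_n}\frac1n\log\frac1{\mathrm P_{\mathrm c}(\Phi_n)}$, the minimum being over all codes of length $n$ with $\frac1n\log|\mathcal M|\le R$. Let $$F^\star(R,D)=\min\Big[D\big(P_{\tilde U\tilde X\tilde Y\tilde Z}\,\big\|\,P_{\tilde Z|\tilde U\tilde Y}P_{\tilde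 U|\tilde X}P_{XY}\big)+\big|I(\tilde U\wedge\tilde X)-I(\tilde U\wedge\tilde Y)-R\big|^+\Big],$$ where the minimum is over all joint distributions $P_{\tilde U\tilde X\tilde Y\tilde Z}$ on $\mathcal U\times\mathcal X\times\mathcal Y\times\mathcal Z$ with $\mathbb E[d(\tilde X,\tilde Y,\tilde Z)]\le D$, for an auxiliary alphabet $\mathcal U$ with $|\mathcal U|=|\mathcal X||\mathcal Y||\mathcal Z|+1$; no Markov constraints are imposed. Exponents take values in $[0,\infty]$, with $\log\frac10=\infty$ and $\min\emptyset=\infty$. Then, for every $R\ge 0$ and $D\ge 0$, the limit $F(R,D)=\lim_{n\to\infty}F^{(n)}(R,D)$ exists in $[0,\infty]$ and $$F(R,D)=F^\star(R,D).$$ Moreover, the minimum defining $F^\star(R,D)$ is attained whenever the constraint set is non-empty, and for every joint distribution $P_{\tilde U\tilde X\tilde Y\tilde Z}$ $$D\big(P_{\tilde U\tilde X\tilde Y\tilde Z}\,\big\|\,P_{\tilde Z|\tilde U\tilde Y}P_{\tilde U|\tilde X}P_{XY}\big)=D(P_{\tilde X\tilde Y}\|P_{XY})+I(\tilde U\wedge\tilde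 Y|\tilde X)+I(\tilde Z\wedge\tilde X|\tilde U,\tilde Y),$$ so that $F^\star(R,D)$ is equally the minimum of $D(P_{\tilde X\tilde Y}\|P_{XY})+I(\tilde U\wedge\tilde Y|\tilde X)+I(\tilde Z\wedge\tilde X|\tilde U,\tilde Y)+|I(\tilde U\wedge\tilde X)-I(\tilde U\wedge\tilde Y)-R|^+$ over the same distributions. -/

import Mathlib

open Filter Topology

namespace WynerZiv

noncomputable section

/-! ### Information quantities on finite alphabets (logarithms to base 2)

A distribution on a finite set `Ω` is a function `p : Ω → ℝ` in `stdSimplex ℝ Ω`, and a random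
variable on `(Ω, p)` is a function out of `Ω`. -/

section Information

variable {Ω α β γ : Type*} [Fintype Ω] [Fintype α] [Fintype β] [Fintype γ]

open Classical in
/-- The distribution `P_A` of the random variable `A` on `(Ω, p)`. -/
def law (p : Ω → ℝ) (A : Ω → α) (a : α) : ℝ := ∑ ω with A ω = a, p ω

/-- The conditional distribution `P_{A|B}(a|b)` (with value `0` where `P_B(b) = 0`). -/
def condLaw (p : Ω → ℝ) (A : Ω → α) (B : Ω → β) (a : α) (b : β) : ℝ :=
  law p (fun ω => (A ω, B ω)) (a, b) / law p B b

/-- The entropy `H(A)`. -/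
def entropy (p : Ω → ℝ) (A : Ω → α) : ℝ := -∑ a, law p A a * Real.logb 2 (law p A a)

/-- The conditional entropy `H(A|B)`. -/
def condEntropy (p : Ω → ℝ) (A : Ω → α) (B : Ω → β) : ℝ :=
  entropy p (fun ω => (A ω, B ω)) - entropy p B

/-- The mutual information `I(A ∧ B)`. -/
def mutualInfo (p : Ω → ℝ) (A : Ω → α) (B : Ω → β) : ℝ := entropy p A - condEntropy p A B

/-- The conditional mutual information `I(A ∧ B | C)`. -/
def condMutualInfo (p : Ω → ℝ) (A : Ω → α) (B : Ω → β) (C : Ω → γ) : ℝ :=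
  condEntropy p A C - condEntropy p A (fun ω => (B ω, C ω))

open Classical in
/-- The divergence `D(p ‖ q)`, equal to `⊤` unless `p` is absolutely continuous w.r.t. `q`. -/
def divergence (p q : α → ℝ) : EReal :=
  if ∀ a, q a = 0 → p a = 0 then ((∑ a, p a * Real.logb 2 (p a / q a) : ℝ) : EReal) else ⊤

end Information

/-! ### Codes and the operational exponent -/

section Operational

variable (X Y Z : Type*)

/-- A block code of length `n` whose message set has `card` elements. -/
structure Code (n : ℕ) where
  /-- the number of messages -/
  card : ℕ
  /-- the encoder -/
  enc : (Fin n → X) → Fin card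
  /-- the decoder, which also sees the side information -/
  dec : Fin card → (Fin n → Y) → (Fin n → Z)

variable {X Y Z}

/-- The additive distortion `d_n(x^n, y^n, z^n)`. -/
def blockDistortion (d : X → Y → Z → ℝ) {n : ℕ} (x : Fin n → X) (y : Fin n → Y)
    (z : Fin n → Z) : ℝ :=
  ∑ j, d (x j) (y j) (z j)

variable [Fintype X] [Fintype Y]

open Classical in
/-- The excess distortion probability of a code, for an i.i.d. source with law `P`. -/
def excessProb (P : X × Y → ℝ) (d : X → Y → Z → ℝ) (D : ℝ) {n : ℕ} (Φ : Code X Y Z n) : ℝ :=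
  ∑ xy : (Fin n → X) × (Fin n → Y)
    with D < (1 / (n : ℝ)) * blockDistortion d xy.1 xy.2 (Φ.dec (Φ.enc xy.1) xy.2),
    ∏ j, P (xy.1 j, xy.2 j)

/-- The non-excess distortion probability of a code. -/
def nonExcessProb (P : X × Y → ℝ) (d : X → Y → Z → ℝ) (D : ℝ) {n : ℕ} (Φ : Code X Y Z n) : ℝ :=
  1 - excessProb P d D Φ

open Classical in
/-- `(1/n) log (1 / P_c(Φ))`, equal to `⊤` if `P_c(Φ) = 0`. -/
def codeExponent (P : X × Y → ℝ) (d : X → Y → Z → ℝ) (D : ℝ) {n : ℕ} (Φ : Code X Y Z n) :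
    EReal :=
  if nonExcessProb P d D Φ = 0 then ⊤
  else (((1 / (n : ℝ)) * Real.logb 2 (1 / nonExcessProb P d D Φ) : ℝ) : EReal)

/-- `F^{(n)}(R, D)`: the least exponent among the codes of length `n` and rate at most `R`. -/
def blockExponent (P : X × Y → ℝ) (d : X → Y → Z → ℝ) (R D : ℝ) (n : ℕ) : EReal :=
  ⨅ Φ : {Φ : Code X Y Z n // (1 / (n : ℝ)) * Real.logb 2 (Φ.card : ℝ) ≤ R},
    codeExponent P d D Φ.1

end Operational

/-! ### The single-letter expression -/

section SingleLetter

variable (X Y Z : Type*) [Fintype X] [Fintype Y] [Fintype Z]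

/-- The auxiliary alphabet, with `|X| |Y| |Z| + 1` elements. -/
abbrev Aux : Type := Fin (Fintype.card X * Fintype.card Y * Fintype.card Z + 1)

/-- The sample space of the quadruple `(Ũ, X̃, Ỹ, Z̃)`. -/
abbrev Quad : Type _ := Aux X Y Z × X × Y × Z

variable {X Y Z}

/-- The random variable `Ũ`. -/
def rvU (ω : Quad X Y Z) : Aux X Y Z := ω.1

/-- The random variable `X̃`. -/
def rvX (ω : Quad X Y Z) : X := ω.2.1

/-- The random variable `Ỹ`. -/
def rvY (ω : Quad X Y Z) : Y := ω.2.2.1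

/-- The random variable `Z̃`. -/
def rvZ (ω : Quad X Y Z) : Z := ω.2.2.2

/-- The product `P_{Z̃|ŨỸ} P_{Ũ|X̃} P_{XY}`, where `Q` is the law of `(Ũ, X̃, Ỹ, Z̃)`. -/
def markovProduct (P : X × Y → ℝ) (Q : Quad X Y Z → ℝ) (ω : Quad X Y Z) : ℝ :=
  condLaw Q rvZ (fun ω' => (rvU ω', rvY ω')) (rvZ ω) (rvU ω, rvY ω)
    * condLaw Q rvU rvX (rvU ω) (rvX ω) * P (rvX ω, rvY ω)

/-- The joint distributions of `(Ũ, X̃, Ỹ, Z̃)` with `E[d(X̃, Ỹ, Z̃)] ≤ D`. -/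
def feasible (d : X → Y → Z → ℝ) (D : ℝ) : Set (Quad X Y Z → ℝ) :=
  {Q | Q ∈ stdSimplex ℝ (Quad X Y Z) ∧ ∑ ω, Q ω * d (rvX ω) (rvY ω) (rvZ ω) ≤ D}

/-- The objective
`D(P_{ŨX̃ỸZ̃} ‖ P_{Z̃|ŨỸ} P_{Ũ|X̃} P_{XY}) + |I(Ũ ∧ X̃) - I(Ũ ∧ Ỹ) - R|^+`. -/
def objective (P : X × Y → ℝ) (R : ℝ) (Q : Quad X Y Z → ℝ) : EReal :=
  divergence Q (markovProduct P Q)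
    + ((max (mutualInfo Q rvU rvX - mutualInfo Q rvU rvY - R) 0 : ℝ) : EReal)

/-- `F*(R, D)`, the infimum of the objective over the feasible distributions
(`⊤` if there are none). -/
def FStar (P : X × Y → ℝ) (d : X → Y → Z → ℝ) (R D : ℝ) : EReal :=
  ⨅ Q ∈ feasible d D, objective P R Q

end SingleLetter

end

end WynerZiv

/-!
The chain rule turns the objective into a maximum of two entropy expressions. With
`L = -E[log P(X, Y)]`, the divergence term is
`H(U,X) + H(U,Y,Z) - H(U,X,Y,Z) - H(U,Y) - H(X) + L` (`markovCost`), and adding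
`I(U ∧ X) - I(U ∧ Y)` to it gives `H(U,Y,Z) - H(U,X,Y,Z) - H(Y) + L` (`binningCost`). So the
objective is `max (markovCost) (binningCost - R)` when the law of `(X, Y)` is absolutely continuous
with respect to `P`, and `⊤` otherwise. Entropies are continuous, so the minimum is attained by
compactness (`exists_objective_eq_FStar`); the decomposition of the divergence is
`divergence_markovProduct_decomposition`.

*Converse* (`FStar_le_blockExponent`, valid for every `n ≥ 1`). Condition `(X^n, Y^n)` on the event
that the code meets the distortion constraint. This changes the measure by a divergence of exactly
`log (1 / P_c)`, after which the distortion constraint holds with certainty. Take `J` uniform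
on the time indices and let the auxiliary variable at time `J = j` consist of `j`, the message, the
past of `X` and the future of `Y`. The entropies in the two costs then telescope, and both
`markovCost` and `binningCost - R` are at most `(1/n) log (1 / P_c)` (`exists_aux_costs_le`). The
alphabet of this auxiliary variable is large. It is reduced by a Carathéodory argument on the
unnormalized slices `P(U = u, ·)`: reweighting them so as to keep the law of `(X, Y, Z)` and
`H(X|U) - H(Y|U)` while not decreasing `H(X|U,Y,Z)` imposes `|X||Y||Z| + 1` linear constraints, so
that many slices suffice (`exists_sparse_weights`, `exists_quad_le`).

*Achievability* (`eventually_blockExponent_lt`). Approximate the given distribution by types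
without increasing the mean distortion (`exists_types_tendsto`). For a type, draw codewords
uniformly from the type class of `U`, assign them to random bins, and let the encoder send the bin
of a codeword jointly typical with `x^n`; the decoder guesses a codeword in the bin that is jointly
typical with `y^n`, and draws `z^n` from the conditional type class. A guess from a list of size `l`
succeeds with probability `1/l ≥ 2τ - τ² l`, so second moments suffice to bound the mean success
probability from below (`exists_code_of_random`). The sizes of type classes grow exponentially at
the rate of the entropies (`tendsto_logb_card_typeClass`), and the resulting exponent is again
`max (markovCost) (binningCost - R)`.
-/

namespace WynerZiv

noncomputable section

/-! ### Entropy of random variables on a finite probability space -/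

section Entropy

variable {Ω α β γ : Type*} [Fintype Ω]

lemma law_nonneg {p : Ω → ℝ} (hp : ∀ ω, 0 ≤ p ω) (A : Ω → α) (a : α) : 0 ≤ law p A a :=
  Finset.sum_nonneg fun ω _ => hp ω

lemma le_law {p : Ω → ℝ} (hp : ∀ ω, 0 ≤ p ω) (A : Ω → α) (ω : Ω) : p ω ≤ law p A (A ω) := by
  classical
  unfold law
  exact Finset.single_le_sum (f := p) (fun ω _ => hp ω) (by simp)

lemma law_pos {p : Ω → ℝ} (hp : ∀ ω, 0 ≤ p ω) (A : Ω → α) {ω : Ω} (h : 0 < p ω) :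
    0 < law p A (A ω) := h.trans_le (le_law hp A ω)

/-- Change of variables. -/
lemma sum_law_mul [Fintype α] (p : Ω → ℝ) (A : Ω → α) (g : α → ℝ) :
    ∑ a, law p A a * g a = ∑ ω, p ω * g (A ω) := by
  classical
  rw [← Finset.sum_fiberwise Finset.univ A (fun ω => p ω * g (A ω))]
  refine Finset.sum_congr rfl fun a _ => ?_
  unfold law
  rw [Finset.sum_mul]
  refine Finset.sum_congr (by congr) fun ω hω => ?_
  rw [(Finset.mem_filter.1 hω).2]

lemma sum_law [Fintype α] (p : Ω → ℝ) (A : Ω → α) : ∑ a, law p A a = ∑ ω, p ω := by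
  simpa using sum_law_mul p A (fun _ => 1)

lemma law_law [Fintype α] (p : Ω → ℝ) (A : Ω → α) (f : α → β) (b : β) :
    law (law p A) f b = law p (fun ω => f (A ω)) b := by
  classical
  have h := sum_law_mul p A (fun a => if f a = b then 1 else 0)
  simp only [mul_ite, mul_one, mul_zero] at h
  unfold law at h ⊢
  rw [Finset.sum_filter, Finset.sum_filter]
  convert h

lemma law_congr (p : Ω → ℝ) {A : Ω → α} {B : Ω → β} {ω : Ω}
    (h : ∀ ω', A ω' = A ω ↔ B ω' = B ω) : law p A (A ω) = law p B (B ω) := by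
  classical
  unfold law
  refine Finset.sum_congr ?_ fun _ _ => rfl
  ext ω'
  simp [h]

lemma law_of_injective (p : Ω → ℝ) {A : Ω → α} (hA : A.Injective) (ω : Ω) :
    law p A (A ω) = p ω := by
  classical
  unfold law
  rw [Finset.sum_filter, Finset.sum_eq_single ω] <;> simp +contextual [hA.eq_iff]

lemma entropy_eq_sum [Fintype α] (p : Ω → ℝ) (A : Ω → α) :
    entropy p A = -∑ ω, p ω * Real.logb 2 (law p A (A ω)) := by
  rw [entropy, sum_law_mul p A (fun a => Real.logb 2 (law p A a))]

lemma entropy_law [Fintype α] [Fintype β] (p : Ω → ℝ) (A : Ω → α) (f : α → β) :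
    entropy (law p A) f = entropy p (fun ω => f (A ω)) := by
  unfold entropy
  simp only [law_law]

/-- The entropy depends only on the partition that a random variable generates. -/
lemma entropy_congr [Fintype α] [Fintype β] (p : Ω → ℝ) {A : Ω → α} {B : Ω → β}
    (h : ∀ ω ω', A ω' = A ω ↔ B ω' = B ω) : entropy p A = entropy p B := by
  rw [entropy_eq_sum, entropy_eq_sum]
  congr 1
  exact Finset.sum_congr rfl fun ω _ => by rw [law_congr p (h ω)]

/-- Submodularity: `H(A|B,C) ≤ H(A|C)`. -/
lemma entropy_submodular [Fintype α] [Fintype β] [Fintype γ] {p : Ω → ℝ} (hp : ∀ ω, 0 ≤ p ω)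
    (A : Ω → α) (B : Ω → β) (C : Ω → γ) :
    entropy p (fun ω => (A ω, B ω, C ω)) + entropy p C ≤
      entropy p (fun ω => (A ω, C ω)) + entropy p (fun ω => (B ω, C ω)) := by
  classical
  set T : Ω → α × β × γ := fun ω => (A ω, B ω, C ω) with hT
  set lT := law p T with hlT
  set lAC := law p (fun ω => (A ω, C ω)) with hlAC
  set lBC := law p (fun ω => (B ω, C ω)) with hlBC
  set lC := law p C with hlC
  have hlog2 : 0 < Real.log 2 := Real.log_pos (by norm_num)
  have nn : ∀ c, 0 ≤ lC c := law_nonneg hp _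
  -- `g` is the density of `P_{A|C} P_{B|C} P_C` with respect to the joint law
  let g : α × β × γ → ℝ := fun t => lAC (t.1, t.2.2) * lBC t.2 / (lT t * lC t.2.2)
  have key : ∀ ω, p ω * (Real.logb 2 (lAC (A ω, C ω)) + Real.logb 2 (lBC (B ω, C ω))
      - Real.logb 2 (lT (T ω)) - Real.logb 2 (lC (C ω))) ≤ (p ω * g (T ω) - p ω) / Real.log 2 := by
    intro ω
    rcases (hp ω).eq_or_lt with h0 | h0
    · simp [← h0]
    have h1 : 0 < lAC (A ω, C ω) := law_pos hp (fun ω => (A ω, C ω)) h0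
    have h2 : 0 < lBC (B ω, C ω) := law_pos hp (fun ω => (B ω, C ω)) h0
    have h3 : 0 < lT (T ω) := law_pos hp T h0
    have h4 : 0 < lC (C ω) := law_pos hp C h0
    have hg : 0 < g (T ω) := by simp only [g, hT]; positivity
    have e : Real.logb 2 (lAC (A ω, C ω)) + Real.logb 2 (lBC (B ω, C ω))
      - Real.logb 2 (lT (T ω)) - Real.logb 2 (lC (C ω)) = Real.log (g (T ω)) / Real.log 2 := by
      have : g (T ω) = lAC (A ω, C ω) * lBC (B ω, C ω) / (lT (T ω) * lC (C ω)) := rfl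
      rw [this, Real.log_div (by positivity) (by positivity), Real.log_mul h1.ne' h2.ne',
        Real.log_mul h3.ne' h4.ne']
      simp only [Real.logb]
      ring
    rw [e, ← mul_sub_one, mul_div_assoc]
    have := Real.log_le_sub_one_of_pos hg
    gcongr
  have hsum := Finset.sum_le_sum fun ω (_ : ω ∈ Finset.univ) => key ω
  rw [← Finset.sum_div, Finset.sum_sub_distrib, ← sum_law_mul p T g] at hsum
  have hmarg : ∑ t, law p T t * g t ≤ ∑ ω, p ω := by
    have h1 : ∀ t, law p T t * g t ≤ lAC (t.1, t.2.2) * lBC t.2 / lC t.2.2 := by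
      intro t
      by_cases h : lT t = 0
      · simp only [← hlT, h, zero_mul]
        have a1 : 0 ≤ lAC (t.1, t.2.2) := law_nonneg hp _ _
        have a2 : 0 ≤ lBC t.2 := law_nonneg hp _ _
        have := nn t.2.2
        positivity
      · apply le_of_eq
        simp only [← hlT, g]
        by_cases h' : lC t.2.2 = 0
        · simp [h']
        · field_simp
    refine (Finset.sum_le_sum fun t _ => h1 t).trans ?_
    have mAC : ∀ c, ∑ a, lAC (a, c) = lC c := by
      intro c
      have := sum_law_mul p (fun ω => (A ω, C ω)) (fun t => if t.2 = c then 1 else 0)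
      rw [Fintype.sum_prod_type] at this
      simp only [mul_ite, mul_one, mul_zero, Finset.sum_ite_eq', Finset.mem_univ, if_true] at this
      rw [hlAC, this, hlC, law, Finset.sum_filter]
    have mBC : ∀ c, ∑ b, lBC (b, c) = lC c := by
      intro c
      have := sum_law_mul p (fun ω => (B ω, C ω)) (fun t => if t.2 = c then 1 else 0)
      rw [Fintype.sum_prod_type] at this
      simp only [mul_ite, mul_one, mul_zero, Finset.sum_ite_eq', Finset.mem_univ, if_true] at this
      rw [hlBC, this, hlC, law, Finset.sum_filter]
    rw [Fintype.sum_prod_type]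
    simp only [Fintype.sum_prod_type]
    rw [Finset.sum_comm]
    have : ∀ b, ∑ a, ∑ c, lAC (a, c) * lBC (b, c) / lC c = ∑ c, lBC (b, c) := by
      intro b
      rw [Finset.sum_comm]
      refine Finset.sum_congr rfl fun c _ => ?_
      rw [← Finset.sum_div, ← Finset.sum_mul, mAC]
      by_cases h : lC c = 0
      · have hb : lBC (b, c) = 0 := by
          have := (Finset.sum_eq_zero_iff_of_nonneg
            (fun b _ => law_nonneg hp (fun ω => (B ω, C ω)) (b, c))).1 ((mBC c).trans h) b
              (Finset.mem_univ b)
          exact this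
        simp [hb]
      · field_simp
    simp only [this]
    rw [Finset.sum_comm]
    simp only [mBC]
    rw [hlC, sum_law]
  have hle : (∑ t, law p T t * g t - ∑ ω, p ω) / Real.log 2 ≤ 0 :=
    div_nonpos_of_nonpos_of_nonneg (by linarith) hlog2.le
  simp only [mul_sub, mul_add, Finset.sum_sub_distrib, Finset.sum_add_distrib] at hsum
  rw [entropy_eq_sum p T, entropy_eq_sum p C, entropy_eq_sum, entropy_eq_sum]
  linarith

lemma entropy_const [Fintype α] {p : Ω → ℝ} (hp : p ∈ stdSimplex ℝ Ω) (a : α) :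
    entropy p (fun _ => a) = 0 := by
  have h : law p (fun _ => a) a = 1 := by simp [law, hp.2]
  simp [entropy_eq_sum, h]

/-- Subadditivity of entropy. -/
lemma entropy_prod_le [Fintype α] [Fintype β] {p : Ω → ℝ} (hp : p ∈ stdSimplex ℝ Ω)
    (A : Ω → α) (B : Ω → β) :
    entropy p (fun ω => (A ω, B ω)) ≤ entropy p A + entropy p B := by
  have h := entropy_submodular hp.1 A B (fun _ => ())
  rw [entropy_const hp] at h
  rw [entropy_congr p (B := fun ω => (A ω, B ω)) (by simp),
    entropy_congr p (A := fun ω => (A ω, ())) (B := A) (by simp),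
    entropy_congr p (A := fun ω => (B ω, ())) (B := B) (by simp)] at h
  linarith

lemma entropy_le_logb_card [Fintype α] {p : Ω → ℝ} (hp : p ∈ stdSimplex ℝ Ω) (A : Ω → α) :
    entropy p A ≤ Real.logb 2 (Fintype.card α) := by
  classical
  have hlog2 : 0 < Real.log 2 := Real.log_pos (by norm_num)
  have hΩ : Nonempty Ω := by
    by_contra h
    rw [not_nonempty_iff] at h
    have := hp.2
    simp at this
  have hα : 0 < (Fintype.card α : ℝ) := by
    have : Nonempty α := hΩ.map A
    exact_mod_cast Fintype.card_pos
  set N : ℝ := (Fintype.card α : ℝ) with hN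
  have key : ∀ a, -(law p A a * Real.logb 2 (law p A a)) - law p A a * Real.logb 2 N ≤
      (1 / N - law p A a) / Real.log 2 := by
    intro a
    rcases (law_nonneg hp.1 A a).eq_or_lt with h0 | h0
    · rw [← h0]; simp only [zero_mul, sub_zero, neg_zero]; positivity
    have h1 := Real.log_le_sub_one_of_pos (show 0 < 1 / (law p A a * N) by positivity)
    rw [one_div, Real.log_inv, Real.log_mul h0.ne' hα.ne'] at h1
    have h2 := mul_le_mul_of_nonneg_left h1 h0.le
    have h3 : law p A a * ((law p A a * N)⁻¹ - 1) = 1 / N - law p A a := by field_simp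
    rw [h3] at h2
    simp only [Real.logb]
    have e : (-(law p A a * (Real.log (law p A a) / Real.log 2)) -
        law p A a * (Real.log N / Real.log 2)) * Real.log 2 =
        law p A a * -(Real.log (law p A a) + Real.log N) := by
      field_simp
      ring
    rw [le_div_iff₀ hlog2, e]
    exact h2
  have hs := Finset.sum_le_sum fun a (_ : a ∈ Finset.univ) => key a
  rw [← Finset.sum_div, Finset.sum_sub_distrib, Finset.sum_sub_distrib, ← Finset.sum_mul,
    sum_law, hp.2, Finset.sum_neg_distrib] at hs
  simp only [Finset.sum_const, Finset.card_univ, nsmul_eq_mul] at hs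
  rw [← hN, mul_one_div_cancel hα.ne', sub_self, zero_div, one_mul] at hs
  rw [entropy]
  linarith

end Entropy

/-! ### The single-letter objective as a maximum of two entropy expressions -/

section Costs

variable {Ω U X Y Z : Type*} [Fintype Ω]

/-- The cross entropy `-E[log P(X, Y)]` of a pair of random variables on `(Ω, p)`. -/
def crossEntropy (P : X × Y → ℝ) (p : Ω → ℝ) (A : Ω → X) (B : Ω → Y) : ℝ :=
  -∑ ω, p ω * Real.logb 2 (P (A ω, B ω))

/-- The entropy expression of `D(P_{UXYZ} ‖ P_{Z|UY} P_{U|X} P)`, for random variables on an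
arbitrary space `(Ω, p)` with `P_{XY}` absolutely continuous with respect to `P`. -/
def markovCost [Fintype U] [Fintype X] [Fintype Y] [Fintype Z]
    (P : X × Y → ℝ) (p : Ω → ℝ) (u : Ω → U) (x : Ω → X) (y : Ω → Y) (z : Ω → Z) : ℝ :=
  entropy p (fun ω => (u ω, x ω)) + entropy p (fun ω => (z ω, u ω, y ω))
    - entropy p (fun ω => (u ω, x ω, y ω, z ω)) - entropy p (fun ω => (u ω, y ω))
    - entropy p x + crossEntropy P p x y

/-- The entropy expression of `D(P_{UXYZ} ‖ P_{Z|UY} P_{U|X} P) + I(U ∧ X) - I(U ∧ Y)`. -/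
def binningCost [Fintype U] [Fintype X] [Fintype Y] [Fintype Z]
    (P : X × Y → ℝ) (p : Ω → ℝ) (u : Ω → U) (x : Ω → X) (y : Ω → Y) (z : Ω → Z) : ℝ :=
  entropy p (fun ω => (z ω, u ω, y ω)) - entropy p (fun ω => (u ω, x ω, y ω, z ω))
    - entropy p y + crossEntropy P p x y

lemma crossEntropy_law {Ω' : Type*} [Fintype Ω'] (P : X × Y → ℝ) (p : Ω → ℝ) (F : Ω → Ω')
    (A : Ω' → X) (B : Ω' → Y) :
    crossEntropy P (law p F) A B = crossEntropy P p (fun ω => A (F ω)) (fun ω => B (F ω)) := by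
  unfold crossEntropy
  rw [sum_law_mul p F fun a => Real.logb 2 (P (A a, B a))]

end Costs

section Objective

variable {X Y Z : Type*} [Fintype X] [Fintype Y] [Fintype Z]

/-- Absolute continuity of the law of `(X̃, Ỹ)` with respect to `P`. -/
def SourceAC (P : X × Y → ℝ) (Q : Quad X Y Z → ℝ) : Prop :=
  ∀ ω, P (rvX ω, rvY ω) = 0 → Q ω = 0

/-- The real-valued form of the objective. -/
def realObjective (P : X × Y → ℝ) (R : ℝ) (Q : Quad X Y Z → ℝ) : ℝ :=
  max (markovCost P Q rvU rvX rvY rvZ) (binningCost P Q rvU rvX rvY rvZ - R)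

lemma markovProduct_eq_zero_iff {P : X × Y → ℝ} {Q : Quad X Y Z → ℝ} (hQ : ∀ ω, 0 ≤ Q ω)
    {ω : Quad X Y Z} (h : 0 < Q ω) : markovProduct P Q ω = 0 ↔ P (rvX ω, rvY ω) = 0 := by
  have h1 := law_pos hQ (fun ω' => (rvZ ω', rvU ω', rvY ω')) h
  have h2 := law_pos hQ (fun ω' => (rvU ω', rvY ω')) h
  have h3 := law_pos hQ (fun ω' => (rvU ω', rvX ω')) h
  have h4 := law_pos hQ rvX h
  simp only [markovProduct, condLaw, mul_eq_zero, div_eq_zero_iff]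
  simp [h1.ne', h2.ne', h3.ne', h4.ne']

lemma divergence_markovProduct {P : X × Y → ℝ} {Q : Quad X Y Z → ℝ} (hQ : ∀ ω, 0 ≤ Q ω)
    (hac : SourceAC P Q) :
    divergence Q (markovProduct P Q) = (markovCost P Q rvU rvX rvY rvZ : ℝ) := by
  rw [divergence, if_pos]
  · congr 1
    have key : ∀ ω, Q ω * Real.logb 2 (Q ω / markovProduct P Q ω) =
        Q ω * Real.logb 2
          (law Q (fun ω => (rvU ω, rvX ω, rvY ω, rvZ ω)) (rvU ω, rvX ω, rvY ω, rvZ ω))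
        - Q ω * Real.logb 2 (law Q (fun ω => (rvZ ω, rvU ω, rvY ω)) (rvZ ω, rvU ω, rvY ω))
        + Q ω * Real.logb 2 (law Q (fun ω => (rvU ω, rvY ω)) (rvU ω, rvY ω))
        - Q ω * Real.logb 2 (law Q (fun ω => (rvU ω, rvX ω)) (rvU ω, rvX ω))
        + Q ω * Real.logb 2 (law Q rvX (rvX ω))
        - Q ω * Real.logb 2 (P (rvX ω, rvY ω)) := by
      intro ω
      rcases (hQ ω).eq_or_lt with h0 | h0
      · simp [← h0]
      have h1 := law_pos hQ (fun ω' => (rvZ ω', rvU ω', rvY ω')) h0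
      have h2 := law_pos hQ (fun ω' => (rvU ω', rvY ω')) h0
      have h3 := law_pos hQ (fun ω' => (rvU ω', rvX ω')) h0
      have h4 := law_pos hQ rvX h0
      have h5 : P (rvX ω, rvY ω) ≠ 0 := fun h => h0.ne' (hac ω h)
      rw [law_of_injective Q (A := fun ω : Quad X Y Z => (rvU ω, rvX ω, rvY ω, rvZ ω))
        (fun _ _ h => h) ω]
      simp only [markovProduct, condLaw]
      rw [Real.logb_div h0.ne' (by positivity), Real.logb_mul (by positivity) h5,
        Real.logb_mul (by positivity) (by positivity), Real.logb_div h1.ne' h2.ne',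
        Real.logb_div h3.ne' h4.ne']
      ring
    simp only [key, Finset.sum_add_distrib, Finset.sum_sub_distrib]
    simp only [markovCost, crossEntropy, entropy_eq_sum]
    ring
  · intro ω h
    by_contra hne
    have hpos : 0 < Q ω := lt_of_le_of_ne (hQ ω) (Ne.symm hne)
    exact hne (hac ω ((markovProduct_eq_zero_iff hQ hpos).1 h))

lemma divergence_markovProduct_eq_top {P : X × Y → ℝ} {Q : Quad X Y Z → ℝ} (hQ : ∀ ω, 0 ≤ Q ω)
    (hac : ¬ SourceAC P Q) : divergence Q (markovProduct P Q) = ⊤ := by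
  rw [divergence, if_neg]
  intro h
  refine hac fun ω hP => ?_
  by_contra hne
  have hpos : 0 < Q ω := lt_of_le_of_ne (hQ ω) (Ne.symm hne)
  exact hne (h ω ((markovProduct_eq_zero_iff hQ hpos).2 hP))

lemma objective_of_sourceAC {P : X × Y → ℝ} (R : ℝ) {Q : Quad X Y Z → ℝ} (hQ : ∀ ω, 0 ≤ Q ω)
    (hac : SourceAC P Q) : objective P R Q = (realObjective P R Q : ℝ) := by
  rw [objective, divergence_markovProduct hQ hac, ← EReal.coe_add, realObjective]
  congr 1
  have : markovCost P Q rvU rvX rvY rvZ + (mutualInfo Q rvU rvX - mutualInfo Q rvU rvY - R) =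
      binningCost P Q rvU rvX rvY rvZ - R := by
    simp only [mutualInfo, condEntropy, markovCost, binningCost]
    ring
  rw [← this, max_comm, ← max_add_add_left, add_zero]

lemma objective_eq_top {P : X × Y → ℝ} (R : ℝ) {Q : Quad X Y Z → ℝ} (hQ : ∀ ω, 0 ≤ Q ω)
    (hac : ¬ SourceAC P Q) : objective P R Q = ⊤ := by
  rw [objective, divergence_markovProduct_eq_top hQ hac]
  exact EReal.top_add_coe _

/-- The divergence from the Markov product is the divergence of the source plus the two
conditional mutual informations that measure the failure of the Markov chains. -/
lemma divergence_markovProduct_decomposition (P : X × Y → ℝ) {Q : Quad X Y Z → ℝ}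
    (hQ : ∀ ω, 0 ≤ Q ω) :
    divergence Q (markovProduct P Q) =
      divergence (law Q (fun ω => (rvX ω, rvY ω))) P
        + ((condMutualInfo Q rvU rvY rvX : ℝ) : EReal)
        + ((condMutualInfo Q rvZ rvX (fun ω => (rvU ω, rvY ω)) : ℝ) : EReal) := by
  by_cases hac : SourceAC P Q
  · rw [divergence_markovProduct hQ hac, divergence, if_pos, ← EReal.coe_add, ← EReal.coe_add]
    · congr 1
      have key : ∀ ω, Q ω * Real.logb 2 (law Q (fun ω => (rvX ω, rvY ω)) (rvX ω, rvY ω)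
          / P (rvX ω, rvY ω)) =
          Q ω * Real.logb 2 (law Q (fun ω => (rvX ω, rvY ω)) (rvX ω, rvY ω))
          - Q ω * Real.logb 2 (P (rvX ω, rvY ω)) := by
        intro ω
        rcases (hQ ω).eq_or_lt with h0 | h0
        · simp [← h0]
        have h1 := law_pos hQ (fun ω' => (rvX ω', rvY ω')) h0
        have h5 : P (rvX ω, rvY ω) ≠ 0 := fun h => h0.ne' (hac ω h)
        rw [Real.logb_div h1.ne' h5]
        ring
      rw [sum_law_mul Q (fun ω => (rvX ω, rvY ω))
        fun a => Real.logb 2 (law Q (fun ω => (rvX ω, rvY ω)) a / P a)]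
      simp only [key, Finset.sum_sub_distrib]
      have e1 : entropy Q (fun ω : Quad X Y Z => (rvY ω, rvX ω)) =
          entropy Q (fun ω => (rvX ω, rvY ω)) :=
        entropy_congr Q (by simp only [Prod.mk.injEq]; tauto)
      have e2 : entropy Q (fun ω : Quad X Y Z => (rvU ω, rvY ω, rvX ω)) =
          entropy Q (fun ω => (rvX ω, rvU ω, rvY ω)) :=
        entropy_congr Q (by simp only [Prod.mk.injEq]; tauto)
      have e3 : entropy Q (fun ω : Quad X Y Z => (rvZ ω, rvX ω, rvU ω, rvY ω)) =
          entropy Q (fun ω => (rvU ω, rvX ω, rvY ω, rvZ ω)) :=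
        entropy_congr Q (by simp only [Prod.mk.injEq]; tauto)
      have e4 := entropy_eq_sum Q (fun ω : Quad X Y Z => (rvX ω, rvY ω))
      simp only [condMutualInfo, condEntropy, markovCost, crossEntropy]
      rw [e1, e2, e3, e4]
      ring
    · rintro ⟨x, y⟩ h
      unfold law
      refine Finset.sum_eq_zero fun ω hω => hac ω ?_
      have : (rvX ω, rvY ω) = (x, y) := by simpa using hω
      rw [this, h]
  · rw [divergence_markovProduct_eq_top hQ hac, divergence, if_neg]
    · rw [EReal.top_add_coe, EReal.top_add_coe]
    · intro h
      refine hac fun ω hP => le_antisymm ?_ (hQ ω)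
      rw [← h _ hP]
      exact le_law hQ (fun ω => (rvX ω, rvY ω)) ω

end Objective

section Compactness

variable {Ω α : Type*} [Fintype Ω]

lemma continuous_law (A : Ω → α) (a : α) : Continuous fun p : Ω → ℝ => law p A a := by
  unfold law
  fun_prop

lemma continuous_entropy [Fintype α] (A : Ω → α) : Continuous fun p : Ω → ℝ => entropy p A := by
  have h : ∀ p : Ω → ℝ, entropy p A = -∑ a, law p A a * Real.log (law p A a) / Real.log 2 := by
    intro p
    simp only [entropy, Real.logb, mul_div_assoc]
  simp only [h]
  refine (continuous_finsetSum _ fun a _ => ?_).neg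
  exact (Real.continuous_mul_log.comp (continuous_law A a)).div_const _

variable {X Y Z : Type*} [Fintype X] [Fintype Y] [Fintype Z]

lemma continuous_realObjective (P : X × Y → ℝ) (R : ℝ) :
    Continuous fun Q : Quad X Y Z → ℝ => realObjective P R Q := by
  unfold realObjective markovCost binningCost crossEntropy
  have h1 := continuous_entropy (fun ω : Quad X Y Z => (rvU ω, rvX ω))
  have h2 := continuous_entropy (fun ω : Quad X Y Z => (rvZ ω, rvU ω, rvY ω))
  have h3 := continuous_entropy (fun ω : Quad X Y Z => (rvU ω, rvX ω, rvY ω, rvZ ω))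
  have h4 := continuous_entropy (fun ω : Quad X Y Z => (rvU ω, rvY ω))
  have h5 := continuous_entropy (rvX : Quad X Y Z → X)
  have h6 := continuous_entropy (rvY : Quad X Y Z → Y)
  fun_prop

/-- The infimum defining `F*` is attained: where it is finite the objective is continuous, and the
feasible distributions with `P_{X̃Ỹ} ≪ P` form a compact set. -/
lemma exists_objective_eq_FStar (P : X × Y → ℝ) (d : X → Y → Z → ℝ) (R D : ℝ)
    (hne : (feasible d D).Nonempty) :
    ∃ Q ∈ feasible d D, objective P R Q = FStar P d R D := by
  let S : Set (Quad X Y Z → ℝ) := {Q | Q ∈ feasible d D ∧ SourceAC P Q}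
  rcases S.eq_empty_or_nonempty with hS | hS
  · have htop : ∀ Q ∈ feasible d D, objective P R Q = ⊤ := by
      intro Q hQ
      refine objective_eq_top R hQ.1.1 fun h => ?_
      have : Q ∈ S := ⟨hQ, h⟩
      rw [hS] at this
      exact this
    obtain ⟨Q, hQ⟩ := hne
    refine ⟨Q, hQ, ?_⟩
    rw [htop Q hQ, FStar]
    symm
    simp only [iInf_eq_top]
    exact htop
  · have hcomp : IsCompact S := by
      refine (isCompact_stdSimplex ℝ (Quad X Y Z)).of_isClosed_subset ?_ fun Q hQ => hQ.1.1
      have h1 : IsClosed (stdSimplex ℝ (Quad X Y Z)) := isClosed_stdSimplex ℝ _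
      have h2 : IsClosed {Q : Quad X Y Z → ℝ | ∑ ω, Q ω * d (rvX ω) (rvY ω) (rvZ ω) ≤ D} :=
        isClosed_le (by fun_prop) continuous_const
      have h3 : IsClosed {Q : Quad X Y Z → ℝ | SourceAC P Q} := by
        simp only [SourceAC, Set.ofPred_forall]
        exact isClosed_iInter fun ω => isClosed_iInter fun _ =>
          isClosed_eq (continuous_apply ω) continuous_const
      exact (h1.inter h2).inter h3
    obtain ⟨Q, hQ, hmin⟩ := hcomp.exists_isMinOn hS (continuous_realObjective P R).continuousOn
    refine ⟨Q, hQ.1, le_antisymm ?_ (iInf₂_le Q hQ.1)⟩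
    refine le_iInf₂ fun Q' hQ' => ?_
    by_cases hac : SourceAC P Q'
    · rw [objective_of_sourceAC R hQ'.1.1 hac, objective_of_sourceAC R hQ.1.1.1 hQ.2]
      exact EReal.coe_le_coe_iff.2 (hmin ⟨hQ', hac⟩)
    · rw [objective_eq_top R hQ'.1.1 hac]
      exact le_top

end Compactness

/-! ### Reducing the auxiliary alphabet -/

section Sparse

lemma sum_subtype_of_eq_zero {ι M : Type*} [Fintype ι] [AddCommMonoid M] (P : ι → Prop)
    [DecidablePred P] (f : ι → M) (h : ∀ i, ¬ P i → f i = 0) :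
    ∑ i : {i // P i}, f i = ∑ i, f i := by
  rw [← Fintype.sum_subtype_add_sum_subtype P f,
    Finset.sum_eq_zero (fun (i : {i // ¬ P i}) _ => h i i.2), add_zero]

/-- A nonnegative combination can be replaced by one with at most `finrank V` nonzero weights and
no larger linear cost: as long as the support is larger, move along a linear relation in the
direction that does not increase the cost until a weight vanishes. Positivity of `ℓ` on the
vectors makes every relation have a negative coefficient. -/
lemma exists_sparse_weights {ι V : Type*} [Fintype ι] [AddCommGroup V] [Module ℝ V]
    [FiniteDimensional ℝ V] (b : ι → V) (ℓ : V →ₗ[ℝ] ℝ) (hℓ : ∀ i, 0 < ℓ (b i)) (c w : ι → ℝ)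
    (hw : ∀ i, 0 ≤ w i) :
    ∃ w' : ι → ℝ, (∀ i, 0 ≤ w' i) ∧ ∑ i, w' i • b i = ∑ i, w i • b i ∧
      ∑ i, w' i * c i ≤ ∑ i, w i * c i ∧
      Fintype.card {i // w' i ≠ 0} ≤ Module.finrank ℝ V := by
  classical
  induction hn : Fintype.card {i // w i ≠ 0} using Nat.strong_induction_on generalizing w with
  | _ n ih =>
  by_cases hcard : n ≤ Module.finrank ℝ V
  · exact ⟨w, hw, rfl, le_rfl, hn ▸ hcard⟩
  have hdep : ¬ LinearIndependent ℝ (fun i : {i // w i ≠ 0} => b i) := fun h =>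
    hcard (hn ▸ h.fintype_card_le_finrank)
  obtain ⟨g, hg0, hgc, hgs, i₁, hi₁⟩ : ∃ g : ι → ℝ, ∑ i, g i • b i = 0 ∧ ∑ i, g i * c i ≤ 0 ∧
      (∀ i, w i = 0 → g i = 0) ∧ ∃ i, g i ≠ 0 := by
    obtain ⟨g', hg', i, hi⟩ := Fintype.not_linearIndependent_iff.1 hdep
    let g : ι → ℝ := fun i => if h : w i ≠ 0 then g' ⟨i, h⟩ else 0
    have e1 : ∑ i, g i • b i = 0 := by
      rw [← hg', ← sum_subtype_of_eq_zero (fun i => w i ≠ 0) (fun i => g i • b i)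
        (fun i hi => by simp [g, not_not.1 hi])]
      refine Finset.sum_congr rfl fun i _ => ?_
      simp [g, i.2]
    have e2 : ∀ i, w i = 0 → g i = 0 := fun i h => by simp [g, h]
    have e3 : g i.1 ≠ 0 := by simpa [g, i.2] using hi
    rcases le_total (∑ i, g i * c i) 0 with h | h
    · exact ⟨g, e1, h, e2, i, e3⟩
    · refine ⟨-g, by simp [e1], by simpa using h, fun i hi => by simp [e2 i hi], i, by simpa⟩
  have hneg : ∃ i, g i < 0 := by
    by_contra! hnn
    have h1 : ∑ i, g i * ℓ (b i) = 0 := by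
      have := congrArg ℓ hg0
      simpa using this
    have h2 := (Finset.sum_eq_zero_iff_of_nonneg
      (fun i _ => mul_nonneg (hnn i) (hℓ i).le)).1 h1 i₁ (Finset.mem_univ _)
    exact hi₁ ((mul_eq_zero.1 h2).resolve_right (hℓ i₁).ne')
  obtain ⟨i₀, hi₀, hmin⟩ := Finset.exists_min_image (Finset.univ.filter fun i => g i < 0)
    (fun i => w i / -g i) (by obtain ⟨i, hi⟩ := hneg; exact ⟨i, by simpa using hi⟩)
  have hi₀' : g i₀ < 0 := by simpa using hi₀
  set t := w i₀ / -g i₀ with ht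
  have ht0 : 0 ≤ t := div_nonneg (hw _) (by linarith)
  let w₁ : ι → ℝ := fun i => w i + t * g i
  have hw₁ : ∀ i, 0 ≤ w₁ i := by
    intro i
    simp only [w₁]
    rcases lt_or_ge (g i) 0 with h | h
    · have := hmin i (by simpa using h)
      rw [le_div_iff₀ (by linarith)] at this
      linarith
    · have := hw i; positivity
  have hz : w₁ i₀ = 0 := by
    have : t * -g i₀ = w i₀ := div_mul_cancel₀ _ (by linarith)
    simp only [w₁]
    linarith
  have hlt : Fintype.card {i // w₁ i ≠ 0} < n := by
    rw [← hn, Fintype.card_subtype, Fintype.card_subtype]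
    refine Finset.card_lt_card (Finset.ssubset_iff_of_subset ?_ |>.2 ⟨i₀, ?_, ?_⟩)
    · intro i hi
      simp only [Finset.mem_filter, Finset.mem_univ, true_and] at hi ⊢
      intro h
      exact hi (by simp [w₁, h, hgs i h])
    · simp only [Finset.mem_filter, Finset.mem_univ, true_and]
      exact fun h => hi₀'.ne (hgs _ h)
    · simp [hz]
  obtain ⟨w', h1, h2, h3, h4⟩ := ih _ hlt w₁ hw₁ rfl
  refine ⟨w', h1, ?_, ?_, h4⟩
  · rw [h2]
    simp only [w₁, add_smul, mul_smul, Finset.sum_add_distrib, ← Finset.smul_sum, hg0, smul_zero,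
      add_zero]
  · refine h3.trans ?_
    simp only [w₁, add_mul, mul_assoc, Finset.sum_add_distrib, ← Finset.mul_sum]
    nlinarith

end Sparse

section Slices

/-- Entropy is homogeneous up to a term that depends on the total mass only. -/
lemma entropy_const_mul {Ω α : Type*} [Fintype Ω] [Fintype α] {p : Ω → ℝ} (hp : ∀ ω, 0 ≤ p ω)
    (c : ℝ) (A : Ω → α) :
    entropy (fun ω => c * p ω) A = c * entropy p A - c * Real.logb 2 c * ∑ ω, p ω := by
  classical
  rcases eq_or_ne c 0 with rfl | hc
  · simp [entropy_eq_sum]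
  rw [entropy_eq_sum, entropy_eq_sum, mul_neg, Finset.mul_sum, Finset.mul_sum,
    ← Finset.sum_neg_distrib, ← Finset.sum_neg_distrib, ← Finset.sum_sub_distrib]
  refine Finset.sum_congr rfl fun ω _ => ?_
  rcases (hp ω).eq_or_lt with h0 | h0
  · simp [← h0]
  have h1 := law_pos hp A h0
  have h2 : law (fun ω => c * p ω) A (A ω) = c * law p A (A ω) := by
    unfold law
    rw [Finset.mul_sum]
  rw [h2, Real.logb_mul hc h1.ne']
  ring

lemma entropy_sub_entropy_const_mul {Ω α β : Type*} [Fintype Ω] [Fintype α] [Fintype β]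
    {p : Ω → ℝ} (hp : ∀ ω, 0 ≤ p ω) (c : ℝ) (A : Ω → α) (B : Ω → β) :
    entropy (fun ω => c * p ω) A - entropy (fun ω => c * p ω) B =
      c * (entropy p A - entropy p B) := by
  rw [entropy_const_mul hp, entropy_const_mul hp]
  ring

lemma law_snd {ι T : Type*} [Fintype ι] [Fintype T] (q : ι × T → ℝ) (t : T) :
    law q Prod.snd t = ∑ i, q (i, t) := by
  classical
  simp [law, Finset.sum_filter, Fintype.sum_prod_type]

/-- The entropy of a pair as a sum of entropies of (unnormalized) slices. -/
lemma entropy_dep_slices {ι T α : Type*} [Fintype ι] [Fintype T] [Fintype α] (q : ι × T → ℝ)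
    (f : ι → T → α) :
    entropy q (fun ω => (ω.1, f ω.1 ω.2)) = ∑ i, entropy (fun t => q (i, t)) (f i) := by
  classical
  simp only [entropy, Fintype.sum_prod_type, Finset.sum_neg_distrib]
  have : ∀ i a, law q (fun ω => (ω.1, f ω.1 ω.2)) (i, a) = law (fun t => q (i, t)) (f i) a := by
    intro i a
    simp only [law, Finset.sum_filter, Fintype.sum_prod_type, Prod.mk.injEq]
    rw [Finset.sum_eq_single i]
    · simp
    · intro j _ hj
      simp [hj]
    · simp
  simp only [this]

lemma entropy_slices {ι T α : Type*} [Fintype ι] [Fintype T] [Fintype α] (q : ι × T → ℝ)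
    (f : T → α) :
    entropy q (fun ω => (ω.1, f ω.2)) = ∑ i, entropy (fun t => q (i, t)) f :=
  entropy_dep_slices q fun _ => f

variable {X Y Z : Type*} [Fintype X] [Fintype Y] [Fintype Z]

lemma markovCost_slices {ι : Type*} [Fintype ι] (P : X × Y → ℝ) (q : ι × X × Y × Z → ℝ) :
    markovCost P q (fun ω => ω.1) (fun ω => ω.2.1) (fun ω => ω.2.2.1) (fun ω => ω.2.2.2) =
      ∑ i, (entropy (fun t => q (i, t)) (fun t => t.1) -
        entropy (fun t => q (i, t)) (fun t => t.2.1))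
      + ∑ i, (entropy (fun t => q (i, t)) (fun t => t.2) - entropy (fun t => q (i, t)) (fun t => t))
      - entropy (law q Prod.snd) (fun t => t.1)
      + crossEntropy P (law q Prod.snd) (fun t => t.1) (fun t => t.2.1) := by
  rw [crossEntropy_law, entropy_law]
  have e : entropy q (fun ω => (ω.2.2.2, ω.1, ω.2.2.1)) = entropy q (fun ω => (ω.1, ω.2.2)) :=
    entropy_congr q (by simp only [Prod.ext_iff]; tauto)
  rw [markovCost, e]
  simp only [Finset.sum_sub_distrib]
  rw [← entropy_slices q, ← entropy_slices q, ← entropy_slices q, ← entropy_slices q]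
  ring

lemma binningCost_slices {ι : Type*} [Fintype ι] (P : X × Y → ℝ) (q : ι × X × Y × Z → ℝ) :
    binningCost P q (fun ω => ω.1) (fun ω => ω.2.1) (fun ω => ω.2.2.1) (fun ω => ω.2.2.2) =
      ∑ i, (entropy (fun t => q (i, t)) (fun t => t.2) - entropy (fun t => q (i, t)) (fun t => t))
      - entropy (law q Prod.snd) (fun t => t.2.1)
      + crossEntropy P (law q Prod.snd) (fun t => t.1) (fun t => t.2.1) := by
  rw [crossEntropy_law, entropy_law]
  have e : entropy q (fun ω => (ω.2.2.2, ω.1, ω.2.2.1)) = entropy q (fun ω => (ω.1, ω.2.2)) :=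
    entropy_congr q (by simp only [Prod.ext_iff]; tauto)
  rw [binningCost, e]
  simp only [Finset.sum_sub_distrib]
  rw [← entropy_slices q, ← entropy_slices q]

lemma markovCost_law {Ω U : Type*} [Fintype Ω] [Fintype U] (P : X × Y → ℝ) (p : Ω → ℝ)
    (u : Ω → U) (x : Ω → X) (y : Ω → Y) (z : Ω → Z) :
    markovCost P (law p (fun ω => (u ω, x ω, y ω, z ω))) (fun ω => ω.1) (fun ω => ω.2.1)
      (fun ω => ω.2.2.1) (fun ω => ω.2.2.2) = markovCost P p u x y z := by
  simp only [markovCost, entropy_law, crossEntropy_law]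

lemma binningCost_law {Ω U : Type*} [Fintype Ω] [Fintype U] (P : X × Y → ℝ) (p : Ω → ℝ)
    (u : Ω → U) (x : Ω → X) (y : Ω → Y) (z : Ω → Z) :
    binningCost P (law p (fun ω => (u ω, x ω, y ω, z ω))) (fun ω => ω.1) (fun ω => ω.2.1)
      (fun ω => ω.2.2.1) (fun ω => ω.2.2.2) = binningCost P p u x y z := by
  simp only [binningCost, entropy_law, crossEntropy_law]

lemma markovCost_relabel {ι : Type*} [Fintype ι] (P : X × Y → ℝ) (q : ι × X × Y × Z → ℝ)
    {e : ι → Aux X Y Z} (he : e.Injective) :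
    markovCost P (law q (fun s => ((e s.1, s.2) : Quad X Y Z))) rvU rvX rvY rvZ =
      markovCost P q (fun ω => ω.1) (fun ω => ω.2.1) (fun ω => ω.2.2.1) (fun ω => ω.2.2.2) := by
  simp only [markovCost, entropy_law, crossEntropy_law, rvU, rvX, rvY, rvZ]
  rw [entropy_congr q (A := fun ω => (e ω.1, ω.2.1)) (B := fun ω => (ω.1, ω.2.1)),
    entropy_congr q (A := fun ω => (ω.2.2.2, e ω.1, ω.2.2.1))
      (B := fun ω => (ω.2.2.2, ω.1, ω.2.2.1)),
    entropy_congr q (A := fun ω => (e ω.1, ω.2.1, ω.2.2.1, ω.2.2.2))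
      (B := fun ω => (ω.1, ω.2.1, ω.2.2.1, ω.2.2.2)),
    entropy_congr q (A := fun ω => (e ω.1, ω.2.2.1)) (B := fun ω => (ω.1, ω.2.2.1))]
  all_goals simp [he.eq_iff]

lemma binningCost_relabel {ι : Type*} [Fintype ι] (P : X × Y → ℝ) (q : ι × X × Y × Z → ℝ)
    {e : ι → Aux X Y Z} (he : e.Injective) :
    binningCost P (law q (fun s => ((e s.1, s.2) : Quad X Y Z))) rvU rvX rvY rvZ =
      binningCost P q (fun ω => ω.1) (fun ω => ω.2.1) (fun ω => ω.2.2.1) (fun ω => ω.2.2.2) := by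
  simp only [binningCost, entropy_law, crossEntropy_law, rvU, rvX, rvY, rvZ]
  rw [entropy_congr q (A := fun ω => (ω.2.2.2, e ω.1, ω.2.2.1))
      (B := fun ω => (ω.2.2.2, ω.1, ω.2.2.1)),
    entropy_congr q (A := fun ω => (e ω.1, ω.2.1, ω.2.2.1, ω.2.2.2))
      (B := fun ω => (ω.1, ω.2.1, ω.2.2.1, ω.2.2.2))]
  all_goals simp [he.eq_iff]

/-- Random variables with an auxiliary `u` in an arbitrary finite alphabet can be replaced by a
distribution with auxiliary alphabet `Aux X Y Z`, keeping the law of `(x, y, z)` and without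
increasing either cost. The slices `P(u = a, ·)` are reweighted; the law of `(x, y, z)` and
`H(X|U) - H(Y|U)` are the `|X||Y||Z| + 1` linear constraints, `-H(X|U,Y,Z)` is the cost. -/
lemma exists_quad_le {Ω U : Type*} [Fintype Ω] [Fintype U] (P : X × Y → ℝ) {p : Ω → ℝ}
    (hp : p ∈ stdSimplex ℝ Ω) (u : Ω → U) (x : Ω → X) (y : Ω → Y) (z : Ω → Z) :
    ∃ Q ∈ stdSimplex ℝ (Quad X Y Z),
      law Q (fun ω => ω.2) = law p (fun ω => (x ω, y ω, z ω)) ∧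
      markovCost P Q rvU rvX rvY rvZ ≤ markovCost P p u x y z ∧
      binningCost P Q rvU rvX rvY rvZ ≤ binningCost P p u x y z := by
  classical
  set q₀ : U × X × Y × Z → ℝ := law p (fun ω => (u ω, x ω, y ω, z ω)) with hq₀
  have hq₀nn : ∀ t, 0 ≤ q₀ t := law_nonneg hp.1 _
  -- only nonzero slices, on which the total mass `ℓ` is positive, enter the reduction
  let μ : U → X × Y × Z → ℝ := fun a t => q₀ (a, t)
  let ι := {a // μ a ≠ 0}
  let b : ι → (X × Y × Z → ℝ) × ℝ := fun a =>
    (μ a, entropy (μ a) (fun t => t.1) - entropy (μ a) (fun t => t.2.1))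
  let ℓ : (X × Y × Z → ℝ) × ℝ →ₗ[ℝ] ℝ :=
    (∑ t, LinearMap.proj (R := ℝ) (φ := fun _ : X × Y × Z => ℝ) t) ∘ₗ LinearMap.fst ℝ _ _
  have hℓ : ∀ a, 0 < ℓ (b a) := by
    intro a
    obtain ⟨t, ht⟩ := Function.ne_iff.1 a.2
    have : ℓ (b a) = ∑ t, μ a t := by simp [ℓ, b]
    rw [this]
    exact Finset.sum_pos' (fun t _ => hq₀nn _)
      ⟨t, Finset.mem_univ _, lt_of_le_of_ne (hq₀nn _) (Ne.symm ht)⟩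
  let c : ι → ℝ := fun a => entropy (μ a) (fun t => t.2) - entropy (μ a) (fun t => t)
  obtain ⟨w, hw, hwb, hwc, hcard⟩ :=
    exists_sparse_weights b ℓ hℓ c (fun _ => 1) (fun _ => zero_le_one)
  let κ := {a // w a ≠ 0}
  have hcard' : Fintype.card κ ≤ Fintype.card (Aux X Y Z) := by
    refine hcard.trans (le_of_eq ?_)
    simp [mul_assoc]
  obtain ⟨e⟩ := Function.Embedding.nonempty_of_card_le hcard'
  -- the reweighted slices that remain
  let q : κ × X × Y × Z → ℝ := fun s => w s.1 * μ s.1 s.2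
  have sumκ : ∀ g : ι → ℝ, ∑ k : κ, w k * g k = ∑ a, w a * g a := fun g =>
    sum_subtype_of_eq_zero (fun a => w a ≠ 0) (fun a => w a * g a)
      fun a ha => by rw [not_not.1 ha, zero_mul]
  have sumι : ∀ g : (X × Y × Z → ℝ) → ℝ, g 0 = 0 → ∑ a : ι, g (μ a) = ∑ a, g (μ a) :=
    fun g hg => sum_subtype_of_eq_zero (fun a => μ a ≠ 0) (fun a => g (μ a))
      fun a ha => by rw [not_not.1 ha, hg]
  have hsnd : law q Prod.snd = law q₀ Prod.snd := by
    funext t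
    have h1 := congrFun (congrArg Prod.fst hwb) t
    simp only [b, Prod.smul_mk, Prod.fst_sum, Finset.sum_apply, Pi.smul_apply, smul_eq_mul,
      one_mul] at h1
    rw [law_snd, law_snd, ← sumι (fun ν => ν t) rfl, ← h1]
    exact sumκ fun a => μ a t
  have hμ : ∀ a t, 0 ≤ μ a t := fun a t => hq₀nn (a, t)
  have hslice : ∀ k : κ, (fun t => q (k, t)) = fun t => w k.1 * μ k.1.1 t := fun _ => rfl
  have hq : ∀ s, 0 ≤ q s := fun s => mul_nonneg (hw s.1) (hμ s.1 s.2)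
  have hφ : ∑ k, (entropy (fun t => q (k, t)) (fun t => t.1) -
      entropy (fun t => q (k, t)) (fun t => t.2.1)) =
      ∑ a, (entropy (μ a) (fun t => t.1) - entropy (μ a) (fun t => t.2.1)) := by
    have h1 := congrArg Prod.snd hwb
    simp only [b, Prod.smul_mk, Prod.snd_sum, smul_eq_mul, one_mul] at h1
    have h2 := sumκ fun a => entropy (μ a) (fun t => t.1) - entropy (μ a) (fun t => t.2.1)
    have h3 := sumι (fun ν => entropy ν (fun t => t.1) - entropy ν (fun t => t.2.1))
      (by simp [entropy_eq_sum])
    refine Eq.trans ?_ (h2.trans (h1.trans h3))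
    refine Finset.sum_congr rfl fun k _ => ?_
    rw [hslice]
    exact entropy_sub_entropy_const_mul (hμ k.1.1) (w k.1) _ _
  have hc : ∑ k, (entropy (fun t => q (k, t)) (fun t => t.2) -
      entropy (fun t => q (k, t)) (fun t => t)) ≤
      ∑ a, (entropy (μ a) (fun t => t.2) - entropy (μ a) (fun t => t)) := by
    have h2 := sumκ c
    have h3 := sumι (fun ν => entropy ν (fun t => t.2) - entropy ν (fun t => t))
      (by simp [entropy_eq_sum])
    simp only [one_mul] at hwc
    refine le_trans (le_of_eq ?_) (h2.trans_le (hwc.trans_eq h3))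
    refine Finset.sum_congr rfl fun k _ => ?_
    rw [hslice]
    exact entropy_sub_entropy_const_mul (hμ k.1.1) (w k.1) _ _
  let F : κ × X × Y × Z → Quad X Y Z := fun s => (e s.1, s.2)
  have hlaw : law (law q F) (fun ω => ω.2) = law q₀ Prod.snd := by
    rw [← hsnd]
    funext t
    exact law_law q F _ t
  have hlaw₀ : law q₀ Prod.snd = law p (fun ω => (x ω, y ω, z ω)) := by
    funext t
    exact law_law p _ _ t
  refine ⟨law q F, ⟨law_nonneg hq F, ?_⟩, hlaw.trans hlaw₀, ?_, ?_⟩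
  · rw [← sum_law (law q F) (fun ω => ω.2), hlaw, hlaw₀, sum_law, hp.2]
  · rw [markovCost_relabel P q e.injective, ← markovCost_law P p u x y z, markovCost_slices,
      markovCost_slices, hsnd, hφ]
    gcongr
  · rw [binningCost_relabel P q e.injective, ← binningCost_law P p u x y z, binningCost_slices,
      binningCost_slices, hsnd]
    gcongr

end Slices

/-! ### Single-letterization -/

section Letters

variable {n : ℕ} {α : Type*}

/-- The first `k` letters of `v`, the others being masked by `none`, so that the type does not
depend on `k`. -/
def initial (k : ℕ) (v : Fin n → α) : Fin n → Option α :=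
  fun i => if i.1 < k then some (v i) else none

/-- The letters of `v` from position `k` on, the others being masked by `none`. -/
def final (k : ℕ) (v : Fin n → α) : Fin n → Option α :=
  fun i => if k ≤ i.1 then some (v i) else none

lemma initial_eq_iff {k : ℕ} {v w : Fin n → α} :
    initial k v = initial k w ↔ ∀ i : Fin n, i.1 < k → v i = w i := by
  rw [funext_iff]
  refine forall_congr' fun i => ?_
  by_cases h : i.1 < k <;> simp [initial, h]

lemma final_eq_iff {k : ℕ} {v w : Fin n → α} :
    final k v = final k w ↔ ∀ i : Fin n, k ≤ i.1 → v i = w i := by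
  rw [funext_iff]
  refine forall_congr' fun i => ?_
  by_cases h : k ≤ i.1 <;> simp [final, h]

lemma initial_succ_eq_iff {j : Fin n} {v w : Fin n → α} :
    initial (j.1 + 1) v = initial (j.1 + 1) w ↔ initial j.1 v = initial j.1 w ∧ v j = w j := by
  simp only [initial_eq_iff]
  constructor
  · exact fun h => ⟨fun i hi => h i (by omega), h j (by omega)⟩
  · rintro ⟨h1, h2⟩ i hi
    rcases Nat.lt_succ_iff_lt_or_eq.1 hi with h | h
    · exact h1 i h
    · rw [Fin.ext h, h2]

lemma final_eq_iff_succ {j : Fin n} {v w : Fin n → α} :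
    final j.1 v = final j.1 w ↔ final (j.1 + 1) v = final (j.1 + 1) w ∧ v j = w j := by
  simp only [final_eq_iff]
  constructor
  · exact fun h => ⟨fun i hi => h i (by omega), h j le_rfl⟩
  · rintro ⟨h1, h2⟩ i hi
    rcases Nat.eq_or_lt_of_le hi with h | h
    · rw [← Fin.ext h, h2]
    · exact h1 i h

lemma initial_length_eq_iff {v w : Fin n → α} : initial n v = initial n w ↔ v = w := by
  rw [initial_eq_iff, funext_iff]
  simp

lemma initial_zero_eq_iff {v w : Fin n → α} : initial 0 v = initial 0 w ↔ True := by
  simp [initial_eq_iff]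

lemma final_zero_eq_iff {v w : Fin n → α} : final 0 v = final 0 w ↔ v = w := by
  rw [final_eq_iff, funext_iff]
  simp

lemma final_length_eq_iff {v w : Fin n → α} : final n v = final n w ↔ True := by
  rw [final_eq_iff, iff_true]
  intro i hi
  omega

variable {Ω : Type*} [Fintype Ω] [Fintype α]

/-- The entropy of a vector is at most the sum of the entropies of its letters. -/
lemma entropy_vec_le {p : Ω → ℝ} (hp : p ∈ stdSimplex ℝ Ω) (v : Ω → Fin n → α) :
    entropy p v ≤ ∑ j, entropy p (fun ω => v ω j) := by
  have h : ∀ j : Fin n, entropy p (fun ω => initial (j.1 + 1) (v ω)) -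
      entropy p (fun ω => initial j.1 (v ω)) ≤ entropy p (fun ω => v ω j) := by
    intro j
    rw [entropy_congr p (A := fun ω => initial (j.1 + 1) (v ω))
      (B := fun ω => (initial j.1 (v ω), v ω j))
      (fun ω ω' => by rw [initial_succ_eq_iff, Prod.mk.injEq])]
    have := entropy_prod_le hp (fun ω => initial j.1 (v ω)) (fun ω => v ω j)
    linarith
  have hs := Finset.sum_le_sum fun j (_ : j ∈ Finset.univ) => h j
  rw [Fin.sum_univ_eq_sum_range (fun j => entropy p (fun ω => initial (j + 1) (v ω)) -
      entropy p (fun ω => initial j (v ω))), Finset.sum_range_sub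
      (fun j => entropy p (fun ω => initial j (v ω)))] at hs
  have h0 : entropy p (fun ω => initial 0 (v ω)) = 0 := by
    rw [entropy_congr p (B := fun _ => ()) (fun ω ω' => by simp [initial_zero_eq_iff]),
      entropy_const hp]
  have hn : entropy p (fun ω => initial n (v ω)) = entropy p v :=
    entropy_congr p (fun ω ω' => initial_length_eq_iff)
  linarith

end Letters

section TimeSharing

variable {n : ℕ} {Ω α : Type*} [Fintype Ω] [Fintype α]

/-- The product of the uniform distribution on `Fin n` with `p`. -/
def timeSharing (n : ℕ) (p : Ω → ℝ) (s : Fin n × Ω) : ℝ := (1 / (n : ℝ)) * p s.2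

lemma timeSharing_mem_stdSimplex {p : Ω → ℝ} (hp : p ∈ stdSimplex ℝ Ω) (hn : n ≠ 0) :
    timeSharing n p ∈ stdSimplex ℝ (Fin n × Ω) := by
  refine ⟨fun s => mul_nonneg (by positivity) (hp.1 _), ?_⟩
  simp only [timeSharing, Fintype.sum_prod_type, ← Finset.mul_sum, hp.2]
  simp [hn]

lemma entropy_timeSharing {p : Ω → ℝ} (hp : p ∈ stdSimplex ℝ Ω) (hn : n ≠ 0)
    (f : Fin n → Ω → α) :
    entropy (timeSharing n p) (fun s => (s.1, f s.1 s.2)) =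
      Real.logb 2 n + (1 / (n : ℝ)) * ∑ j, entropy p (f j) := by
  rw [entropy_dep_slices]
  simp only [timeSharing, entropy_const_mul hp.1, hp.2, mul_one, Finset.sum_sub_distrib,
    ← Finset.mul_sum]
  rw [Finset.sum_const, Finset.card_univ, Fintype.card_fin, nsmul_eq_mul, one_div, Real.logb_inv]
  field_simp
  ring

/-- A vector of length `n` has at most `n` times the entropy of a letter at a uniform position. -/
lemma average_entropy_le {p : Ω → ℝ} (hp : p ∈ stdSimplex ℝ Ω) (hn : n ≠ 0) (v : Ω → Fin n → α) :
    (1 / (n : ℝ)) * entropy p v ≤ entropy (timeSharing n p) (fun s => v s.2 s.1) := by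
  have hq := timeSharing_mem_stdSimplex hp hn
  have h1 := entropy_prod_le hq (fun s => s.1) (fun s => v s.2 s.1)
  rw [entropy_timeSharing hp hn fun j ω => v ω j] at h1
  have h2 := entropy_le_logb_card hq (fun s => s.1)
  rw [Fintype.card_fin] at h2
  have h3 := mul_le_mul_of_nonneg_left (entropy_vec_le hp v) (show 0 ≤ 1 / (n : ℝ) by positivity)
  linarith

variable {X Y Z M : Type*} [Fintype X] [Fintype Y] [Fintype Z] [Fintype M]

/-- Single-letterization of a block code. The auxiliary variable at time `j` consists of `j`, the
message, the past of the source and the future of the side information. -/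
lemma exists_aux_costs_le (P : X × Y → ℝ) {p : Ω → ℝ} (hp : p ∈ stdSimplex ℝ Ω) (hn : n ≠ 0)
    (x : Ω → Fin n → X) (y : Ω → Fin n → Y) (z : Ω → Fin n → Z) (m : Ω → M)
    (hm : ∀ ω ω', x ω' = x ω → m ω' = m ω)
    (hz : ∀ ω ω', m ω' = m ω → y ω' = y ω → z ω' = z ω) :
    ∃ u : Fin n × Ω → Fin n × M × (Fin n → Option X) × (Fin n → Option Y),
      markovCost P (timeSharing n p) u (fun s => x s.2 s.1) (fun s => y s.2 s.1)
          (fun s => z s.2 s.1) ≤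
        -(1 / (n : ℝ)) * entropy p (fun ω => (x ω, y ω)) +
          crossEntropy P (timeSharing n p) (fun s => x s.2 s.1) (fun s => y s.2 s.1) ∧
      binningCost P (timeSharing n p) u (fun s => x s.2 s.1) (fun s => y s.2 s.1)
          (fun s => z s.2 s.1) ≤
        -(1 / (n : ℝ)) * entropy p (fun ω => (x ω, y ω)) +
          (1 / (n : ℝ)) * Real.logb 2 (Fintype.card M) +
          crossEntropy P (timeSharing n p) (fun s => x s.2 s.1) (fun s => y s.2 s.1) := by
  let v : Fin n → Ω → M × (Fin n → Option X) × (Fin n → Option Y) := fun j ω =>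
    (m ω, initial j.1 (x ω), final (j.1 + 1) (y ω))
  refine ⟨fun s => (s.1, v s.1 s.2), ?_⟩
  set c : ℝ := 1 / (n : ℝ) with hc
  have hc0 : 0 ≤ c := by positivity
  -- `I(X_j ; U_j)` and `I(Y_j ; U_j)` telescope against each other through `S`; `V` bounds the sum
  -- of the `H(X_j | U_j, Y_j, Z_j)` from below, since `Z^n` is a function of the message and `Y^n`
  let S : ℕ → ℝ := fun j => entropy p (fun ω => (m ω, initial j (x ω), final j (y ω)))
  let V : ℕ → ℝ := fun j => entropy p (fun ω => (m ω, initial j (x ω), y ω))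
  have hux : ∀ j : Fin n, entropy p (fun ω => (v j ω, x ω j)) = S (j.1 + 1) := fun j =>
    entropy_congr p fun ω ω' => by simp only [v, Prod.mk.injEq, initial_succ_eq_iff]; tauto
  have huy : ∀ j : Fin n, entropy p (fun ω => (v j ω, y ω j)) = S j.1 := fun j =>
    entropy_congr p fun ω ω' => by simp only [v, Prod.mk.injEq, final_eq_iff_succ]; tauto
  have hV : ∀ j : Fin n, entropy p (fun ω => (z ω j, v j ω, y ω j)) -
      entropy p (fun ω => (x ω j, z ω j, v j ω, y ω j)) ≤ V j.1 - V (j.1 + 1) := by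
    intro j
    have h := entropy_submodular hp.1 (fun ω => x ω j) y (fun ω => (z ω j, v j ω, y ω j))
    have h1 : entropy p (fun ω => (x ω j, y ω, z ω j, v j ω, y ω j)) = V (j.1 + 1) :=
      entropy_congr p fun ω ω' => by
        simp only [v, Prod.mk.injEq, initial_succ_eq_iff]
        constructor
        · tauto
        · rintro ⟨h1, ⟨h2, h3⟩, h4⟩
          rw [hz ω ω' h1 h4, h4]
          tauto
    have h2 : entropy p (fun ω => (y ω, z ω j, v j ω, y ω j)) = V j.1 :=
      entropy_congr p fun ω ω' => by
        simp only [v, Prod.mk.injEq]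
        constructor
        · tauto
        · rintro ⟨h1, h2, h4⟩
          rw [hz ω ω' h1 h4, h4]
          tauto
    linarith
  have hSsum : ∑ j : Fin n, (S (j.1 + 1) - S j.1) = S n - S 0 := by
    rw [Fin.sum_univ_eq_sum_range (fun j => S (j + 1) - S j), Finset.sum_range_sub]
  have hVsum : ∑ j : Fin n, (V j.1 - V (j.1 + 1)) = V 0 - V n := by
    rw [Fin.sum_univ_eq_sum_range (fun j => V j - V (j + 1)), Finset.sum_range_sub']
  have hSn : S n = entropy p x := entropy_congr p fun ω ω' => by
    simp only [Prod.mk.injEq, initial_length_eq_iff, final_length_eq_iff, and_true]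
    exact ⟨fun h => h.2, fun h => ⟨hm _ _ h, h⟩⟩
  have hS0 : S 0 = entropy p (fun ω => (m ω, y ω)) := entropy_congr p fun ω ω' => by
    simp only [Prod.mk.injEq, final_zero_eq_iff, initial_zero_eq_iff, true_and]
  have hVn : V n = entropy p (fun ω => (x ω, y ω)) := entropy_congr p fun ω ω' => by
    simp only [Prod.mk.injEq, initial_length_eq_iff]
    exact ⟨fun h => h.2, fun h => ⟨hm _ _ h.1, h⟩⟩
  have hV0 : V 0 = entropy p (fun ω => (m ω, y ω)) := entropy_congr p fun ω ω' => by
    simp only [Prod.mk.injEq, initial_zero_eq_iff, true_and]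
  -- the single-letter entropies
  have e1 : entropy (timeSharing n p) (fun s => ((s.1, v s.1 s.2), x s.2 s.1)) =
      Real.logb 2 n + c * ∑ j : Fin n, S (j.1 + 1) := by
    rw [← Finset.sum_congr rfl fun j _ => hux j, ← entropy_timeSharing hp hn]
    exact entropy_congr _ fun ω ω' => by simp only [Prod.mk.injEq]; tauto
  have e2 : entropy (timeSharing n p) (fun s => ((s.1, v s.1 s.2), y s.2 s.1)) =
      Real.logb 2 n + c * ∑ j : Fin n, S j.1 := by
    rw [← Finset.sum_congr rfl fun j _ => huy j, ← entropy_timeSharing hp hn]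
    exact entropy_congr _ fun ω ω' => by simp only [Prod.mk.injEq]; tauto
  have e3 : entropy (timeSharing n p) (fun s => (z s.2 s.1, (s.1, v s.1 s.2), y s.2 s.1)) =
      Real.logb 2 n + c * ∑ j : Fin n, entropy p (fun ω => (z ω j, v j ω, y ω j)) := by
    rw [← entropy_timeSharing hp hn fun j ω => (z ω j, v j ω, y ω j)]
    exact entropy_congr _ fun ω ω' => by simp only [Prod.mk.injEq]; tauto
  have e4 : entropy (timeSharing n p)
      (fun s => ((s.1, v s.1 s.2), x s.2 s.1, y s.2 s.1, z s.2 s.1)) =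
      Real.logb 2 n + c * ∑ j : Fin n, entropy p (fun ω => (x ω j, z ω j, v j ω, y ω j)) := by
    rw [← entropy_timeSharing hp hn fun j ω => (x ω j, z ω j, v j ω, y ω j)]
    exact entropy_congr _ fun ω ω' => by simp only [Prod.mk.injEq]; tauto
  have hVle := mul_le_mul_of_nonneg_left
    ((Finset.sum_le_sum fun j (_ : j ∈ Finset.univ) => hV j).trans_eq hVsum) hc0
  rw [Finset.sum_sub_distrib] at hVle
  have hSeq := congrArg (c * ·) hSsum
  simp only [Finset.sum_sub_distrib] at hSeq
  have hx := average_entropy_le hp hn x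
  have hy := average_entropy_le hp hn y
  have hmy := mul_le_mul_of_nonneg_left ((entropy_prod_le hp m y).trans
    (add_le_add_left (entropy_le_logb_card hp m) _)) hc0
  rw [hVn, hV0] at hVle
  rw [hSn, hS0] at hSeq
  rw [← hc] at hx hy
  constructor
  · simp only [markovCost]
    rw [e1, e2, e3, e4]
    linarith
  · simp only [binningCost]
    rw [e3, e4]
    linarith

end TimeSharing

/-! ### The converse: change of measure -/

section Converse

variable {X Y Z : Type*} [Fintype X] [Fintype Y]

/-- The law of `(X^n, Y^n)`. -/
def blockLaw (P : X × Y → ℝ) (n : ℕ) (xy : (Fin n → X) × (Fin n → Y)) : ℝ :=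
  ∏ j, P (xy.1 j, xy.2 j)

lemma blockLaw_nonneg {P : X × Y → ℝ} (hP : P ∈ stdSimplex ℝ (X × Y)) {n : ℕ}
    (xy : (Fin n → X) × (Fin n → Y)) : 0 ≤ blockLaw P n xy :=
  Finset.prod_nonneg fun _ _ => hP.1 _

lemma sum_blockLaw {P : X × Y → ℝ} (hP : P ∈ stdSimplex ℝ (X × Y)) (n : ℕ) :
    ∑ xy, blockLaw P n xy = 1 := by
  classical
  rw [← (Equiv.arrowProdEquivProdArrow (Fin n) (fun _ => X) (fun _ => Y)).sum_comp]
  have h := Finset.prod_univ_sum (fun _ : Fin n => (Finset.univ : Finset (X × Y)))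
    (fun _ a => P a)
  simp only [hP.2, Finset.prod_const_one, Fintype.piFinset_univ] at h
  rw [h]
  rfl

/-- The event that the code meets the distortion constraint. -/
def GoodBlock (d : X → Y → Z → ℝ) (D : ℝ) {n : ℕ} (Φ : Code X Y Z n)
    (xy : (Fin n → X) × (Fin n → Y)) : Prop :=
  (1 / (n : ℝ)) * blockDistortion d xy.1 xy.2 (Φ.dec (Φ.enc xy.1) xy.2) ≤ D

open Classical in
lemma nonExcessProb_eq {P : X × Y → ℝ} (hP : P ∈ stdSimplex ℝ (X × Y)) (d : X → Y → Z → ℝ) (D : ℝ)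
    {n : ℕ} (Φ : Code X Y Z n) :
    nonExcessProb P d D Φ = ∑ xy with GoodBlock d D Φ xy, blockLaw P n xy := by
  rw [nonExcessProb, ← sum_blockLaw hP n, sub_eq_iff_eq_add', excessProb,
    ← Finset.sum_filter_add_sum_filter_not Finset.univ (fun xy => D < (1 / (n : ℝ)) *
      blockDistortion d xy.1 xy.2 (Φ.dec (Φ.enc xy.1) xy.2))]
  simp only [GoodBlock, not_lt]
  rfl

lemma logb_blockLaw {A B : Type*} {P : A × B → ℝ} {n : ℕ} {xy : (Fin n → A) × (Fin n → B)}
    (h : blockLaw P n xy ≠ 0) :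
    Real.logb 2 (blockLaw P n xy) = ∑ j, Real.logb 2 (P (xy.1 j, xy.2 j)) := by
  simp only [Real.logb]
  rw [← Finset.sum_div, blockLaw, Real.log_prod]
  exact fun j _ hj => h (Finset.prod_eq_zero (Finset.mem_univ j) hj)

open Classical in
/-- The law of `(X^n, Y^n)` conditioned on the event that the distortion constraint is met. -/
def goodLaw (P : X × Y → ℝ) (d : X → Y → Z → ℝ) (D : ℝ) {n : ℕ} (Φ : Code X Y Z n)
    (xy : (Fin n → X) × (Fin n → Y)) : ℝ :=
  if GoodBlock d D Φ xy then blockLaw P n xy / nonExcessProb P d D Φ else 0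

lemma goodLaw_mem_stdSimplex {P : X × Y → ℝ} (hP : P ∈ stdSimplex ℝ (X × Y)) (d : X → Y → Z → ℝ)
    (D : ℝ) {n : ℕ} {Φ : Code X Y Z n} (h : nonExcessProb P d D Φ ≠ 0) :
    goodLaw P d D Φ ∈ stdSimplex ℝ _ := by
  classical
  constructor
  · intro xy
    have h0 : 0 ≤ nonExcessProb P d D Φ := by
      rw [nonExcessProb_eq hP]
      exact Finset.sum_nonneg fun xy _ => blockLaw_nonneg hP xy
    have := blockLaw_nonneg hP xy
    unfold goodLaw
    split_ifs <;> positivity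
  · simp only [goodLaw]
    rw [← Finset.sum_filter, ← Finset.sum_div, ← nonExcessProb_eq hP, div_self h]

lemma goodBlock_of_goodLaw_ne_zero {P : X × Y → ℝ} {d : X → Y → Z → ℝ} {D : ℝ} {n : ℕ}
    {Φ : Code X Y Z n} {xy : (Fin n → X) × (Fin n → Y)} (h : goodLaw P d D Φ xy ≠ 0) :
    GoodBlock d D Φ xy ∧ blockLaw P n xy ≠ 0 ∧
      goodLaw P d D Φ xy = blockLaw P n xy / nonExcessProb P d D Φ := by
  classical
  have hg : GoodBlock d D Φ xy := by
    by_contra hg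
    simp [goodLaw, hg] at h
  refine ⟨hg, ?_, by simp [goodLaw, hg]⟩
  rintro h0
  simp [goodLaw, h0] at h

/-- Conditioning on an event of probability `P_c` costs divergence `log (1 / P_c)`. -/
lemma average_divergence_goodLaw {P : X × Y → ℝ} (hP : P ∈ stdSimplex ℝ (X × Y))
    (d : X → Y → Z → ℝ) (D : ℝ) {n : ℕ} {Φ : Code X Y Z n}
    (h : nonExcessProb P d D Φ ≠ 0) :
    -(1 / (n : ℝ)) * entropy (goodLaw P d D Φ) (fun xy => (xy.1, xy.2)) +
        crossEntropy P (timeSharing n (goodLaw P d D Φ)) (fun s => s.2.1 s.1)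
          (fun s => s.2.2 s.1) =
      (1 / (n : ℝ)) * Real.logb 2 (1 / nonExcessProb P d D Φ) := by
  have hp := goodLaw_mem_stdSimplex hP d D h
  set p := goodLaw P d D Φ with hpdef
  have hcross : crossEntropy P (timeSharing n p) (fun s => s.2.1 s.1) (fun s => s.2.2 s.1) =
      -(1 / (n : ℝ) * ∑ xy, p xy * ∑ j, Real.logb 2 (P (xy.1 j, xy.2 j))) := by
    rw [crossEntropy, Fintype.sum_prod_type, Finset.sum_comm]
    simp only [timeSharing, Finset.mul_sum, mul_assoc]
  rw [entropy_eq_sum, hcross]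
  have key : ∀ xy, p xy * Real.logb 2 (law p (fun xy => (xy.1, xy.2)) (xy.1, xy.2)) =
      p xy * ∑ j, Real.logb 2 (P (xy.1 j, xy.2 j)) -
        p xy * Real.logb 2 (nonExcessProb P d D Φ) := by
    intro xy
    rw [law_of_injective p (A := fun xy : (Fin n → X) × (Fin n → Y) => (xy.1, xy.2))
      (fun _ _ h => h)]
    by_cases h0 : p xy = 0
    · simp [h0]
    obtain ⟨_, h1, h2⟩ := goodBlock_of_goodLaw_ne_zero h0
    rw [← mul_sub, ← logb_blockLaw h1, ← Real.logb_div h1 h, ← h2]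
  simp only [key, Finset.sum_sub_distrib]
  rw [← Finset.sum_mul, hp.2, one_div (nonExcessProb P d D Φ), Real.logb_inv]
  ring

/-- The single-letter expression bounds the exponent of every code from below. -/
lemma FStar_le_blockExponent [Fintype Z] {P : X × Y → ℝ} (hP : P ∈ stdSimplex ℝ (X × Y))
    (d : X → Y → Z → ℝ) (R D : ℝ) {n : ℕ} (hn : n ≠ 0) :
    FStar P d R D ≤ blockExponent P d R D n := by
  classical
  refine le_iInf fun ⟨Φ, hΦ⟩ => ?_
  rw [codeExponent]
  split_ifs with h
  · exact le_top
  have hp := goodLaw_mem_stdSimplex hP d D h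
  have hdiv := average_divergence_goodLaw hP d D h
  set p := goodLaw P d D Φ with hpdef
  have hq := timeSharing_mem_stdSimplex hp hn
  obtain ⟨u, hA, hB⟩ := exists_aux_costs_le P hp hn (fun xy => xy.1) (fun xy => xy.2)
    (fun xy => Φ.dec (Φ.enc xy.1) xy.2) (fun xy => Φ.enc xy.1)
    (fun _ _ h => congrArg Φ.enc h) (fun _ _ h1 h2 => congrArg₂ Φ.dec h1 h2)
  rw [hdiv] at hA
  rw [add_right_comm, hdiv, Fintype.card_fin] at hB
  obtain ⟨Q, hQ, hQlaw, hQA, hQB⟩ := exists_quad_le P hq u (fun s => s.2.1 s.1)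
    (fun s => s.2.2 s.1) (fun s => Φ.dec (Φ.enc s.2.1) s.2.2 s.1)
  have hsum : ∀ g : X × Y × Z → ℝ, ∑ ω, Q ω * g ω.2 = ∑ xy, p xy * ((1 / (n : ℝ)) *
      ∑ j, g (xy.1 j, xy.2 j, Φ.dec (Φ.enc xy.1) xy.2 j)) := by
    intro g
    rw [← sum_law_mul Q (fun ω => ω.2) g, hQlaw, sum_law_mul, Fintype.sum_prod_type,
      Finset.sum_comm]
    refine Finset.sum_congr rfl fun xy _ => ?_
    rw [Finset.mul_sum, Finset.mul_sum]
    refine Finset.sum_congr rfl fun j _ => ?_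
    simp only [timeSharing]
    ring
  have hfeas : Q ∈ feasible d D := by
    refine ⟨hQ, ?_⟩
    refine (hsum fun t => d t.1 t.2.1 t.2.2).trans_le ?_
    calc _ ≤ ∑ xy, p xy * D := Finset.sum_le_sum fun xy _ => ?_
      _ = D := by rw [← Finset.sum_mul, hp.2, one_mul]
    by_cases h0 : p xy = 0
    · simp [h0]
    · exact mul_le_mul_of_nonneg_left (goodBlock_of_goodLaw_ne_zero h0).1 (hp.1 xy)
  have hac : SourceAC P Q := by
    intro ω hω
    have h1 := hsum fun t => if P (t.1, t.2.1) = 0 then 1 else 0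
    have h2 : ∑ xy, p xy * ((1 / (n : ℝ)) *
        ∑ j, if P (xy.1 j, xy.2 j) = 0 then (1 : ℝ) else 0) = 0 := by
      refine Finset.sum_eq_zero fun xy _ => ?_
      by_cases h0 : p xy = 0
      · simp [h0]
      · have h3 := (goodBlock_of_goodLaw_ne_zero h0).2.1
        have : ∀ j, P (xy.1 j, xy.2 j) ≠ 0 := fun j hj =>
          h3 (Finset.prod_eq_zero (Finset.mem_univ j) hj)
        simp [this]
    rw [h2] at h1
    have h3 := (Finset.sum_eq_zero_iff_of_nonneg fun ω _ =>
      mul_nonneg (hQ.1 ω) (by split_ifs <;> norm_num)).1 h1 ω (Finset.mem_univ ω)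
    have h4 : P (ω.2.1, ω.2.2.1) = 0 := hω
    simpa [h4] using h3
  refine (iInf₂_le Q hfeas).trans ?_
  rw [objective_of_sourceAC R hQ.1 hac, EReal.coe_le_coe_iff]
  refine max_le (hQA.trans hA) ?_
  linarith

end Converse

/-! ### Random coding with binning for a single block -/

section RandomCoding

/-- Under a product distribution, functions of two different coordinates are uncorrelated. -/
lemma sum_prod_mul_mul {ι W : Type*} [Fintype ι] [DecidableEq ι] [Fintype W] {ν : W → ℝ}
    (hν : ∑ s, ν s = 1) {i j : ι} (hij : i ≠ j) (g h : W → ℝ) :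
    ∑ c : ι → W, (∏ k, ν (c k)) * (g (c i) * h (c j)) =
      (∑ s, ν s * g s) * ∑ s, ν s * h s := by
  classical
  have e1 : ∀ c : ι → W, (∏ k, ν (c k)) * (g (c i) * h (c j)) =
      ∏ k, ν (c k) * ((if k = i then g (c k) else 1) * (if k = j then h (c k) else 1)) := by
    intro c
    simp only [Finset.prod_mul_distrib]
    simp
  have e2 := Finset.prod_univ_sum (fun _ : ι => (Finset.univ : Finset W))
    (fun k s => ν s * ((if k = i then g s else 1) * (if k = j then h s else 1)))
  simp only [e1]
  rw [Fintype.piFinset_univ] at e2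
  rw [← e2]
  have e3 : ∀ k, ∑ s, ν s * ((if k = i then g s else 1) * (if k = j then h s else 1)) =
      (if k = i then ∑ s, ν s * g s else 1) * (if k = j then ∑ s, ν s * h s else 1) := by
    intro k
    by_cases hi : k = i
    · have hj : k ≠ j := hi ▸ hij
      simp only [hi, if_true, if_neg hij, mul_one]
    · by_cases hj : k = j
      · have hji : j ≠ i := hij.symm
        simp only [hj, if_true, if_neg hji, one_mul]
      · simp [hi, hj, hν]
  simp only [e3, Finset.prod_mul_distrib]
  simp

lemma sum_prod_mul {ι W : Type*} [Fintype ι] [DecidableEq ι] [Fintype W] {ν : W → ℝ}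
    (hν : ∑ s, ν s = 1) (i : ι) (g : W → ℝ) :
    ∑ c : ι → W, (∏ k, ν (c k)) * g (c i) = ∑ s, ν s * g s := by
  classical
  have e1 : ∀ c : ι → W, (∏ k, ν (c k)) * g (c i) =
      ∏ k, ν (c k) * (if k = i then g (c k) else 1) := by
    intro c
    rw [Finset.prod_mul_distrib]
    simp
  have e2 := Finset.prod_univ_sum (fun _ : ι => (Finset.univ : Finset W))
    (fun k s => ν s * (if k = i then g s else 1))
  simp only [e1]
  rw [Fintype.piFinset_univ] at e2
  rw [← e2]
  have e3 : ∀ k, ∑ s, ν s * (if k = i then g s else 1) = if k = i then ∑ s, ν s * g s else 1 := by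
    intro k
    by_cases hi : k = i <;> simp [hi, hν]
  simp only [e3]
  simp

lemma exists_le_of_sum_le {W : Type*} [Fintype W] {ν : W → ℝ} (hν0 : ∀ s, 0 ≤ ν s)
    (hν : ∑ s, ν s = 1) {f : W → ℝ} {r : ℝ} (h : r ≤ ∑ s, ν s * f s) : ∃ s, r ≤ f s := by
  by_contra! hlt
  have hne : ∃ s, 0 < ν s := by
    by_contra! hle
    have : ∑ s, ν s ≤ 0 := Finset.sum_nonpos fun s _ => hle s
    linarith
  obtain ⟨s₀, hs₀⟩ := hne
  have : ∑ s, ν s * f s < ∑ s, ν s * r :=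
    Finset.sum_lt_sum (fun s _ => mul_le_mul_of_nonneg_left (hlt s).le (hν0 s))
      ⟨s₀, Finset.mem_univ _, mul_lt_mul_of_pos_left (hlt s₀) hs₀⟩
  rw [← Finset.sum_mul, hν, one_mul] at this
  linarith

/-- A randomized decoder can be replaced by a deterministic one that does at least as well. -/
lemma exists_decoder {A B C M : Type*} [Fintype A] [Fintype B] [Fintype C] [Fintype M]
    [Nonempty C] (enc : A → M) (μ : M → B → C → ℝ) (hμ0 : ∀ m y z, 0 ≤ μ m y z)
    (hμ1 : ∀ m y, ∑ z, μ m y z ≤ 1) (F : A → B → C → ℝ) (hF : ∀ x y z, 0 ≤ F x y z) :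
    ∃ dec : M → B → C,
      ∑ x, ∑ y, ∑ z, μ (enc x) y z * F x y z ≤ ∑ x, ∑ y, F x y (dec (enc x) y) := by
  classical
  have h : ∀ m y, ∃ z, ∑ z', μ m y z' * ∑ x with enc x = m, F x y z' ≤
      ∑ x with enc x = m, F x y z := by
    intro m y
    obtain ⟨z, -, hz⟩ := Finset.exists_max_image Finset.univ
      (fun z => ∑ x with enc x = m, F x y z) Finset.univ_nonempty
    refine ⟨z, ?_⟩
    calc _ ≤ ∑ z', μ m y z' * ∑ x with enc x = m, F x y z :=
          Finset.sum_le_sum fun z' _ =>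
            mul_le_mul_of_nonneg_left (hz z' (Finset.mem_univ _)) (hμ0 _ _ _)
      _ ≤ 1 * ∑ x with enc x = m, F x y z := by
          rw [← Finset.sum_mul]
          exact mul_le_mul_of_nonneg_right (hμ1 m y) (Finset.sum_nonneg fun x _ => hF _ _ _)
      _ = _ := one_mul _
  choose dec hdec using h
  refine ⟨dec, ?_⟩
  rw [Finset.sum_comm, Finset.sum_comm (s := Finset.univ (α := A))]
  refine Finset.sum_le_sum fun y _ => ?_
  rw [← Finset.sum_fiberwise Finset.univ enc, ← Finset.sum_fiberwise Finset.univ enc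
    (fun x => F x y (dec (enc x) y))]
  refine Finset.sum_le_sum fun m _ => ?_
  calc _ = ∑ x with enc x = m, ∑ z, μ m y z * F x y z := by
        refine Finset.sum_congr rfl fun x hx => ?_
        rw [(Finset.mem_filter.1 hx).2]
    _ = ∑ z', μ m y z' * ∑ x with enc x = m, F x y z' := by
        rw [Finset.sum_comm]
        simp only [Finset.mul_sum]
    _ ≤ _ := hdec m y
    _ = _ := by
        refine Finset.sum_congr rfl fun x hx => ?_
        rw [(Finset.mem_filter.1 hx).2]

variable {U A B C : Type*} [Fintype A] [Fintype B] [Fintype C]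

open Classical in
/-- The indices of the codewords in bin `m` that are compatible with the side information `y`. -/
def decodingList {M N : ℕ} (b : U → B → Prop) (c : Fin N → U × Fin M) (m : Fin M) (y : B) :
    Finset (Fin N) := {i | (c i).2 = m ∧ b (c i).1 y}

open Classical in
/-- Performance of a fixed codebook: the encoder sends the bin of a codeword compatible with `x`;
the decoder draws a codeword uniformly from its list and then an output from `κ`. Only the event
that exactly one codeword is compatible with `x` is counted. -/
lemma exists_code_of_codebook [Nonempty C] {M N : ℕ} [NeZero M] {a : U → A → Prop}
    {b : U → B → Prop} {t : U → A → B → Prop} {good : A → B → C → Prop} {κ : U → B → C → ℝ} {q : ℝ}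
    (S : Finset (A × B)) (hκ0 : ∀ u y z, 0 ≤ κ u y z) (hκ1 : ∀ u y, ∑ z, κ u y z ≤ 1)
    (hta : ∀ u x y, t u x y → a u x) (htb : ∀ u x y, t u x y → b u y)
    (hgood : ∀ u x y, t u x y → q ≤ ∑ z with good x y z, κ u y z)
    (c : Fin N → U × Fin M) :
    ∃ (enc : A → Fin M) (dec : Fin M → B → C),
      ∑ xy ∈ S, ∑ i, (if t (c i).1 xy.1 xy.2 ∧ ∀ k, k ≠ i → ¬ a (c k).1 xy.1 then
        q / ((decodingList b c (c i).2 xy.2).card : ℝ) else 0) ≤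
      ({xy ∈ S | good xy.1 xy.2 (dec (enc xy.1) xy.2)}.card : ℝ) := by
  let enc : A → Fin M := fun x => if h : ∃ i, a (c i).1 x then (c h.choose).2 else 0
  let μ : Fin M → B → C → ℝ := fun m y z =>
    (∑ i ∈ decodingList b c m y, κ (c i).1 y z) / ((decodingList b c m y).card : ℝ)
  have hμ0 : ∀ m y z, 0 ≤ μ m y z := fun m y z =>
    div_nonneg (Finset.sum_nonneg fun i _ => hκ0 _ _ _) (Nat.cast_nonneg _)
  have hμ1 : ∀ m y, ∑ z, μ m y z ≤ 1 := by
    intro m y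
    simp only [μ]
    rw [← Finset.sum_div, Finset.sum_comm]
    refine div_le_one_of_le₀ ?_ (Nat.cast_nonneg _)
    refine (Finset.sum_le_sum fun i _ => hκ1 _ _).trans ?_
    simp
  let F : A → B → C → ℝ := fun x y z => if (x, y) ∈ S ∧ good x y z then 1 else 0
  obtain ⟨dec, hdec⟩ := exists_decoder enc μ hμ0 hμ1 F (fun x y z => by
    simp only [F]; split_ifs <;> norm_num)
  refine ⟨enc, dec, ?_⟩
  have hr : ∑ x, ∑ y, F x y (dec (enc x) y) =
      ({xy ∈ S | good xy.1 xy.2 (dec (enc xy.1) xy.2)}.card : ℝ) := by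
    rw [← Fintype.sum_prod_type' (f := fun x y => F x y (dec (enc x) y))]
    simp only [F, Finset.sum_boole]
    congr 2
    ext xy
    simp
  rw [← hr]
  refine le_trans ?_ hdec
  rw [← Fintype.sum_prod_type' (f := fun x y => ∑ z, μ (enc x) y z * F x y z),
    ← Finset.sum_subset (Finset.subset_univ S)
      (fun xy _ hxy => Finset.sum_eq_zero fun z _ => by simp [F, hxy])]
  refine Finset.sum_le_sum fun xy hxy => ?_
  obtain ⟨x, y⟩ := xy
  have hnn : 0 ≤ ∑ z, μ (enc x) y z * F x y z :=
    Finset.sum_nonneg fun z _ => mul_nonneg (hμ0 _ _ _) (by simp only [F]; split_ifs <;> norm_num)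
  by_cases hex : ∃ i, t (c i).1 x y ∧ ∀ k, k ≠ i → ¬ a (c k).1 x
  · obtain ⟨i, hi, huniq⟩ := hex
    rw [Finset.sum_eq_single i]
    · rw [if_pos ⟨hi, huniq⟩]
      have hxi : ∃ k, a (c k).1 x := ⟨i, hta _ _ _ hi⟩
      have henc : enc x = (c i).2 := by
        simp only [enc, dif_pos hxi]
        congr 1
        congr 1
        by_contra hne
        exact huniq _ hne hxi.choose_spec
      rw [henc]
      have hmem : i ∈ decodingList b c (c i).2 y := by
        simp [decodingList, htb _ _ _ hi]
      have hF : ∀ z, μ (c i).2 y z * F x y z = if good x y z then μ (c i).2 y z else 0 := by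
        intro z
        simp [F, hxy]
      simp only [hF]
      rw [← Finset.sum_filter]
      refine (div_le_div_of_nonneg_right (hgood _ _ _ hi) (Nat.cast_nonneg _)).trans ?_
      rw [Finset.sum_div]
      refine Finset.sum_le_sum fun z _ => ?_
      refine div_le_div_of_nonneg_right ?_ (Nat.cast_nonneg _)
      exact Finset.single_le_sum (f := fun i => κ (c i).1 y z) (fun k _ => hκ0 _ _ _) hmem
    · intro k _ hk
      rw [if_neg]
      rintro ⟨h1, -⟩
      exact huniq k hk (hta _ _ _ h1)
    · simp
  · rw [Finset.sum_eq_zero]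
    · exact hnn
    · intro i _
      rw [if_neg]
      exact fun h => hex ⟨i, h⟩

open Classical in
/-- Random coding: the codewords are independent and uniform, with uniform bins. The expected
number of codewords compatible with `x` besides the right one is at most `1/2`, and a list of
expected size at most `1 + N p_y / M` has to be guessed from. -/
lemma exists_code_of_random [Fintype U] [Nonempty C] [Nonempty U] {M N : ℕ} [NeZero M]
    {a : U → A → Prop} {b : U → B → Prop} {t : U → A → B → Prop}
    {good : A → B → C → Prop} {κ : U → B → C → ℝ} {q : ℝ}
    (S : Finset (A × B)) (hκ0 : ∀ u y z, 0 ≤ κ u y z) (hκ1 : ∀ u y, ∑ z, κ u y z ≤ 1)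
    (hta : ∀ u x y, t u x y → a u x) (htb : ∀ u x y, t u x y → b u y)
    (hq : 0 ≤ q) (hgood : ∀ u x y, t u x y → q ≤ ∑ z with good x y z, κ u y z)
    {px py pxy : ℝ} (hpy : 0 ≤ py) (hpxy : 0 ≤ pxy)
    (ha : ∀ xy ∈ S, (({u | a u xy.1} : Finset U).card : ℝ) = px * Fintype.card U)
    (hb : ∀ xy ∈ S, (({u | b u xy.2} : Finset U).card : ℝ) = py * Fintype.card U)
    (ht : ∀ xy ∈ S, (({u | t u xy.1 xy.2} : Finset U).card : ℝ) = pxy * Fintype.card U)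
    (hN : ((N : ℝ) - 1) * px ≤ 1 / 2) :
    ∃ (enc : A → Fin M) (dec : Fin M → B → C),
      (S.card : ℝ) * (N * pxy * q / (4 * (1 + N * py / M))) ≤
      ({xy ∈ S | good xy.1 xy.2 (dec (enc xy.1) xy.2)}.card : ℝ) := by
  have hM : (0 : ℝ) < M := by exact_mod_cast Nat.pos_of_neZero M
  have hU : (0 : ℝ) < Fintype.card U := by exact_mod_cast Fintype.card_pos
  let W := U × Fin M
  let ν : W → ℝ := fun _ => 1 / (Fintype.card U * M)
  have hν0 : ∀ s, 0 ≤ ν s := fun _ => by positivity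
  have hν : ∑ s, ν s = 1 := by
    simp only [ν, Finset.sum_const, Finset.card_univ, nsmul_eq_mul]
    rw [Fintype.card_prod, Fintype.card_fin, Nat.cast_mul, mul_one_div_cancel (by positivity)]
  let w : (Fin N → W) → ℝ := fun c => ∏ k, ν (c k)
  have hw0 : ∀ c, 0 ≤ w c := fun c => Finset.prod_nonneg fun k _ => hν0 (c k)
  have hw : ∑ c, w c = 1 := by
    have := Finset.prod_univ_sum (fun _ : Fin N => (Finset.univ : Finset W)) (fun _ s => ν s)
    simp only [hν, Finset.prod_const_one, Fintype.piFinset_univ] at this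
    exact this.symm
  set r := N * py / M with hr
  have hr0 : 0 ≤ r := by positivity
  -- maximizes `τ - τ ^ 2 * (1 + r)`, the lower bound on the success probability given below
  set τ : ℝ := 1 / (2 * (1 + r)) with hτ
  have hτ0 : 0 < τ := by positivity
  let succ : (Fin N → W) → A × B → ℝ := fun c xy =>
    ∑ i, (if t (c i).1 xy.1 xy.2 ∧ ∀ k, k ≠ i → ¬ a (c k).1 xy.1 then
        q / ((decodingList b c (c i).2 xy.2).card : ℝ) else 0)
  suffices h : ∀ xy ∈ S, N * pxy * q / (4 * (1 + r)) ≤ ∑ c, w c * succ c xy by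
    have h1 : (S.card : ℝ) * (N * pxy * q / (4 * (1 + r))) ≤ ∑ c, w c * ∑ xy ∈ S, succ c xy := by
      simp only [Finset.mul_sum]
      rw [Finset.sum_comm, ← nsmul_eq_mul, ← Finset.sum_const]
      exact Finset.sum_le_sum h
    obtain ⟨c, hc⟩ := exists_le_of_sum_le hw0 hw h1
    obtain ⟨enc, dec, hed⟩ := exists_code_of_codebook S hκ0 hκ1 hta htb hgood c
    exact ⟨enc, dec, hc.trans hed⟩
  rintro ⟨x, y⟩ hxy
  -- Indicator functions of a codeword, and their expectations. Two codewords lie in the same bin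
  -- if they lie in bin `m` for some `m`; summing `T' m (c i) * β m (c k)` over `m` thus keeps every
  -- term a product of functions of single codewords.
  let T : W → ℝ := fun s => if t s.1 x y then 1 else 0
  let α : W → ℝ := fun s => if a s.1 x then 1 else 0
  let T' : Fin M → W → ℝ := fun m s => if s.2 = m ∧ t s.1 x y then 1 else 0
  let β : Fin M → W → ℝ := fun m s => if s.2 = m ∧ b s.1 y then 1 else 0
  have wsum : ∀ f : W → ℝ, ∑ s, f s = ∑ u, ∑ m, f (u, m) := fun f => Fintype.sum_prod_type f
  have exp1 : ∀ (P : U → Prop) (p : ℝ), (({u | P u} : Finset U).card : ℝ) = p * Fintype.card U →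
      ∑ s, ν s * (if P s.1 then 1 else 0) = p := by
    intro P p h
    rw [wsum]
    simp only [ν, ← Finset.mul_sum]
    rw [Finset.sum_comm]
    simp only [Finset.sum_boole, h, Finset.sum_const, Finset.card_univ, Fintype.card_fin,
      nsmul_eq_mul]
    field_simp
  have exp2 : ∀ (P : U → Prop) (p : ℝ), (({u | P u} : Finset U).card : ℝ) = p * Fintype.card U →
      ∀ m, ∑ s, ν s * (if s.2 = m ∧ P s.1 then 1 else 0) = p / M := by
    intro P p h m
    rw [wsum]
    simp only [ν, ← Finset.mul_sum, ite_and, Finset.sum_ite_eq', Finset.mem_univ, if_true,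
      Finset.sum_boole]
    rw [h]
    field_simp
  have hT : ∑ s, ν s * T s = pxy := exp1 _ _ (ht _ hxy)
  have hα : ∑ s, ν s * α s = px := exp1 _ _ (ha _ hxy)
  have hT' : ∀ m, ∑ s, ν s * T' m s = pxy / M := exp2 _ _ (ht _ hxy)
  have hβ : ∀ m, ∑ s, ν s * β m s = py / M := exp2 _ _ (hb _ hxy)
  -- with `1 - ∑ α` for the indicator that no other codeword is compatible with `x`, the success
  -- probability is bounded by sums over pairs of codewords
  have hlow : ∀ c, q * ∑ i, (T (c i) * (2 * τ - τ ^ 2) - ∑ k ∈ Finset.univ.erase i,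
      (2 * τ * (T (c i) * α (c k)) + τ ^ 2 * ∑ m, T' m (c i) * β m (c k))) ≤ succ c (x, y) := by
    intro c
    simp only [succ]
    rw [Finset.mul_sum]
    refine Finset.sum_le_sum fun i _ => ?_
    by_cases hti : t (c i).1 x y
    · set l : ℝ := ((decodingList b c (c i).2 y).card : ℝ) with hl
      have hlist : l = 1 + ∑ k ∈ Finset.univ.erase i, ∑ m, T' m (c i) * β m (c k) := by
        have hk : ∀ k, ∑ m, T' m (c i) * β m (c k) =
            if (c k).2 = (c i).2 ∧ b (c k).1 y then 1 else 0 := by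
          intro k
          rw [Finset.sum_eq_single (c i).2]
          · simp [T', β, hti]
          · intro m _ hm
            simp [T', Ne.symm hm]
          · simp
        have hi : (if (c i).2 = (c i).2 ∧ b (c i).1 y then (1 : ℝ) else 0) = 1 := by
          simp [htb _ _ _ hti]
        have e := Finset.add_sum_erase Finset.univ
          (fun k => if (c k).2 = (c i).2 ∧ b (c k).1 y then (1 : ℝ) else 0) (Finset.mem_univ i)
        rw [hi] at e
        simp only [hk]
        rw [e, Finset.sum_boole, hl, decodingList]
      have hl1 : 1 ≤ l := by
        rw [hlist]
        have : 0 ≤ ∑ k ∈ Finset.univ.erase i, ∑ m, T' m (c i) * β m (c k) :=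
          Finset.sum_nonneg fun k _ => Finset.sum_nonneg fun m _ => by
            simp only [T', β]; split_ifs <;> norm_num
        linarith
      have hTi : T (c i) = 1 := by simp [T, hti]
      have hsum : ∑ k ∈ Finset.univ.erase i,
          (2 * τ * (T (c i) * α (c k)) + τ ^ 2 * ∑ m, T' m (c i) * β m (c k)) =
          2 * τ * ∑ k ∈ Finset.univ.erase i, α (c k) + τ ^ 2 * (l - 1) := by
        rw [Finset.sum_add_distrib, hlist, hTi, add_sub_cancel_left, Finset.mul_sum,
          Finset.mul_sum]
        simp only [one_mul]
      rw [hsum, hTi]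
      -- `1 / l ≥ 2 τ - τ ^ 2 l`
      have hinv : 2 * τ - τ ^ 2 * l ≤ 1 / l := by
        rw [le_div_iff₀ (by linarith)]
        nlinarith [sq_nonneg (τ * l - 1)]
      have hα0 : 0 ≤ ∑ k ∈ Finset.univ.erase i, α (c k) :=
        Finset.sum_nonneg fun k _ => by simp only [α]; split_ifs <;> norm_num
      by_cases hA : ∀ k, k ≠ i → ¬ a (c k).1 x
      · rw [if_pos ⟨hti, hA⟩, div_eq_mul_one_div]
        refine mul_le_mul_of_nonneg_left ?_ hq
        nlinarith
      · rw [if_neg (fun h => hA h.2)]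
        refine mul_nonpos_of_nonneg_of_nonpos hq ?_
        push Not at hA
        obtain ⟨k, hk, hak⟩ := hA
        have h1 : 1 ≤ ∑ k ∈ Finset.univ.erase i, α (c k) := by
          have := Finset.single_le_sum (f := fun k => α (c k)) (s := Finset.univ.erase i)
            (fun k _ => by simp only [α]; split_ifs <;> norm_num)
            (Finset.mem_erase.2 ⟨hk, Finset.mem_univ k⟩)
          simpa [α, hak] using this
        nlinarith
    · simp [hti, T, T']
  have hexp : ∑ c, w c * (q * ∑ i, (T (c i) * (2 * τ - τ ^ 2) - ∑ k ∈ Finset.univ.erase i,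
      (2 * τ * (T (c i) * α (c k)) + τ ^ 2 * ∑ m, T' m (c i) * β m (c k)))) =
      q * (N * (pxy * (2 * τ - τ ^ 2) -
        (N - 1) * (2 * τ * (pxy * px) + τ ^ 2 * (M * (pxy / M * (py / M)))))) := by
    have hi : ∀ i, ∑ c, w c * (T (c i) * (2 * τ - τ ^ 2) - ∑ k ∈ Finset.univ.erase i,
        (2 * τ * (T (c i) * α (c k)) + τ ^ 2 * ∑ m, T' m (c i) * β m (c k))) =
        pxy * (2 * τ - τ ^ 2) -
        (N - 1) * (2 * τ * (pxy * px) + τ ^ 2 * (M * (pxy / M * (py / M)))) := by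
      intro i
      have h1 : ∑ c, w c * (T (c i) * (2 * τ - τ ^ 2)) = pxy * (2 * τ - τ ^ 2) := by
        simp only [← mul_assoc]
        rw [← Finset.sum_mul, sum_prod_mul hν i T, hT]
      have h2 : ∀ k ∈ Finset.univ.erase i, ∑ c, w c * (2 * τ * (T (c i) * α (c k)) +
          τ ^ 2 * ∑ m, T' m (c i) * β m (c k)) =
          2 * τ * (pxy * px) + τ ^ 2 * (M * (pxy / M * (py / M))) := by
        intro k hk
        have hki : i ≠ k := (Finset.ne_of_mem_erase hk).symm
        have h3 : ∑ c, w c * (2 * τ * (T (c i) * α (c k))) = 2 * τ * (pxy * px) := by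
          rw [← hT, ← hα, ← sum_prod_mul_mul hν hki T α, Finset.mul_sum]
          exact Finset.sum_congr rfl fun c _ => by simp only [w]; ring
        have h4 : ∑ c, w c * (τ ^ 2 * ∑ m, T' m (c i) * β m (c k)) =
            τ ^ 2 * (M * (pxy / M * (py / M))) := by
          have h5 : ∀ m, ∑ c, w c * (T' m (c i) * β m (c k)) = pxy / M * (py / M) := by
            intro m
            rw [← hT' m, ← hβ m, ← sum_prod_mul_mul hν hki (T' m) (β m)]
          calc _ = τ ^ 2 * ∑ m, ∑ c, w c * (T' m (c i) * β m (c k)) := by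
                rw [Finset.sum_comm, Finset.mul_sum]
                refine Finset.sum_congr rfl fun c _ => ?_
                rw [← Finset.mul_sum]
                ring
            _ = _ := by simp [h5]
        simp only [mul_add, Finset.sum_add_distrib] at h3 h4 ⊢
        rw [h3, h4]
      simp only [mul_sub, Finset.sum_sub_distrib] at h1 ⊢
      rw [h1]
      congr 1
      simp only [Finset.mul_sum (s := Finset.univ.erase i)]
      rw [Finset.sum_comm, Finset.sum_congr rfl h2, Finset.sum_const, nsmul_eq_mul,
        Finset.card_erase_of_mem (Finset.mem_univ i), Finset.card_univ, Fintype.card_fin,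
        Nat.cast_sub i.pos, Nat.cast_one]
    calc _ = q * ∑ i, ∑ c, w c * (T (c i) * (2 * τ - τ ^ 2) - ∑ k ∈ Finset.univ.erase i,
        (2 * τ * (T (c i) * α (c k)) + τ ^ 2 * ∑ m, T' m (c i) * β m (c k))) := by
          rw [Finset.sum_comm, Finset.mul_sum]
          refine Finset.sum_congr rfl fun c _ => ?_
          rw [← Finset.mul_sum]
          ring
      _ = _ := by
          simp only [hi]
          rw [Finset.sum_const, Finset.card_univ, Fintype.card_fin, nsmul_eq_mul]
  calc N * pxy * q / (4 * (1 + r)) = q * (N * pxy * (τ - τ ^ 2 * (1 + r))) := by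
        rw [hτ]; field_simp; ring
    _ ≤ q * (N * (pxy * (2 * τ - τ ^ 2) -
        (N - 1) * (2 * τ * (pxy * px) + τ ^ 2 * (M * (pxy / M * (py / M)))))) := by
        have e : (N : ℝ) * (pxy * (2 * τ - τ ^ 2) -
            (N - 1) * (2 * τ * (pxy * px) + τ ^ 2 * (M * (pxy / M * (py / M))))) =
            N * pxy * (2 * τ - τ ^ 2 - 2 * τ * ((N - 1) * px) - τ ^ 2 * (r - py / M)) := by
          rw [hr]; field_simp; ring
        rw [e]
        refine mul_le_mul_of_nonneg_left (mul_le_mul_of_nonneg_left ?_ (by positivity)) hq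
        have : 0 ≤ τ ^ 2 * (py / M) := by positivity
        nlinarith
    _ ≤ ∑ c, w c * succ c (x, y) := by
        rw [← hexp]
        exact Finset.sum_le_sum fun c _ => mul_le_mul_of_nonneg_left (hlow c) (hw0 c)

end RandomCoding

/-! ### Type classes -/

section TypeClass

variable {α β γ : Type*} {n : ℕ}

open Classical in
/-- The sequences of length `n` in which each letter `s` occurs exactly `k s` times. -/
def typeClass [Fintype α] (k : α → ℕ) (n : ℕ) : Finset (Fin n → α) :=
  {a | ∀ s, Fintype.card {j // a j = s} = k s}

open Classical in
/-- The letter counts of `f ∘ a` when `a` has letter counts `k`. -/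
def pushCount [Fintype α] (k : α → ℕ) (f : α → β) (b : β) : ℕ := ∑ s with f s = b, k s

lemma mem_typeClass [Fintype α] [DecidableEq α] {k : α → ℕ} {a : Fin n → α} :
    a ∈ typeClass k n ↔ ∀ s, Fintype.card {j // a j = s} = k s := by
  simp only [typeClass, Finset.mem_filter, Finset.mem_univ, true_and]
  refine forall_congr' fun s => ?_
  rw [iff_iff_eq]
  congr!

lemma sum_pushCount [Fintype α] [Fintype β] (k : α → ℕ) (f : α → β) :
    ∑ b, pushCount k f b = ∑ s, k s := by
  classical
  unfold pushCount
  rw [← Finset.sum_fiberwise Finset.univ f k]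

lemma pushCount_pushCount [Fintype α] [Fintype β] (k : α → ℕ) (f : α → β) (g : β → γ) :
    pushCount (pushCount k f) g = pushCount k (g ∘ f) := by
  classical
  funext c
  unfold pushCount
  rw [Finset.sum_comm' (t' := Finset.univ.filter fun s => (g ∘ f) s = c) (s' := fun s => {f s})]
  · simp
  · intro b s
    simp only [Finset.mem_filter, Finset.mem_univ, true_and, Finset.mem_singleton,
      Function.comp_apply]
    constructor
    · rintro ⟨h1, h2⟩; exact ⟨h2.symm, by rw [h2, h1]⟩
    · rintro ⟨h1, h2⟩; exact ⟨by rw [h1, h2], h1.symm⟩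

lemma sum_comp_of_mem_typeClass [Fintype α] {M : Type*} [AddCommMonoid M] {k : α → ℕ}
    {a : Fin n → α} (h : a ∈ typeClass k n) (g : α → M) : ∑ j, g (a j) = ∑ s, k s • g s := by
  classical
  rw [mem_typeClass] at h
  rw [← Finset.sum_fiberwise Finset.univ a]
  refine Finset.sum_congr rfl fun s _ => ?_
  rw [← h s, Fintype.card_subtype, ← Finset.sum_const]
  exact Finset.sum_congr rfl fun j hj => by rw [(Finset.mem_filter.1 hj).2]

lemma comp_mem_typeClass [Fintype α] [Fintype β] {k : α → ℕ} {a : Fin n → α}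
    (h : a ∈ typeClass k n) (f : α → β) : f ∘ a ∈ typeClass (pushCount k f) n := by
  classical
  rw [mem_typeClass]
  intro b
  have h1 := sum_comp_of_mem_typeClass h (fun s => if f s = b then 1 else 0)
  simp only [smul_eq_mul, mul_ite, mul_one, mul_zero, ← Finset.sum_filter] at h1
  rw [Fintype.card_subtype, Finset.card_eq_sum_ones]
  unfold pushCount
  convert h1
  rfl

lemma typeClass_nonempty [Fintype α] {k : α → ℕ} (hk : ∑ s, k s = n) :
    (typeClass k n).Nonempty := by
  classical
  have e : (Σ s, Fin (k s)) ≃ Fin n := Fintype.equivFinOfCardEq (by simp [hk])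
  refine ⟨fun j => (e.symm j).1, ?_⟩
  rw [mem_typeClass]
  intro s
  rw [← Fintype.card_fin (k s)]
  refine Fintype.card_congr ?_
  refine (e.symm.subtypeEquiv (q := fun t => t.1 = s) fun j => Iff.rfl).trans ?_
  exact Equiv.sigmaSubtype s

lemma comp_perm_mem_typeClass [Fintype α] {k : α → ℕ} {a : Fin n → α} (h : a ∈ typeClass k n)
    (σ : Equiv.Perm (Fin n)) : a ∘ σ ∈ typeClass k n := by
  classical
  rw [mem_typeClass] at h ⊢
  intro s
  rw [← h s]
  exact Fintype.card_congr (σ.subtypeEquiv fun j => Iff.rfl)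

/-- The symmetric group acts transitively on a type class. -/
lemma exists_perm_of_mem_typeClass [Fintype α] {k : α → ℕ} {a b : Fin n → α}
    (ha : a ∈ typeClass k n) (hb : b ∈ typeClass k n) : ∃ σ : Equiv.Perm (Fin n), a ∘ σ = b := by
  classical
  rw [mem_typeClass] at ha hb
  let e : ∀ s, {j // b j = s} ≃ {j // a j = s} := fun s =>
    Fintype.equivOfCardEq ((hb s).trans (ha s).symm)
  exact ⟨Equiv.ofFiberEquiv e, funext fun j => Equiv.ofFiberEquiv_map e j⟩

/-- The multinomial formula, by the orbit-stabilizer count for permutations of the positions. -/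
lemma card_typeClass_mul_prod_factorial [Fintype α] {k : α → ℕ} (hk : ∑ s, k s = n) :
    (typeClass k n).card * ∏ s, (k s).factorial = n.factorial := by
  classical
  obtain ⟨a, ha⟩ := typeClass_nonempty hk
  have h1 : Fintype.card {g : Equiv.Perm (Fin n) // a ∘ g = a} = ∏ s, (k s).factorial := by
    rw [DomMulAct.stabilizer_card]
    exact Finset.prod_congr rfl fun s _ => by rw [mem_typeClass.1 ha s]
  have h2 : ∀ b ∈ typeClass k n,
      (Finset.univ.filter fun σ : Equiv.Perm (Fin n) => a ∘ σ = b).card =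
        ∏ s, (k s).factorial := by
    intro b hb
    obtain ⟨τ, hτ⟩ := exists_perm_of_mem_typeClass ha hb
    rw [← h1, ← Fintype.card_subtype]
    refine Fintype.card_congr ((Equiv.mulRight τ⁻¹).subtypeEquiv fun σ => ?_)
    rw [← hτ]
    constructor
    · intro h
      funext j
      have := congrFun h (τ⁻¹ j)
      simpa using this
    · intro h
      funext j
      have := congrFun h (τ j)
      simpa using this
  have h3 := Finset.card_eq_sum_card_fiberwise (s := (Finset.univ : Finset (Equiv.Perm (Fin n))))
    (t := typeClass k n) (f := fun σ : Equiv.Perm (Fin n) => a ∘ σ)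
    (fun σ _ => by simpa using comp_perm_mem_typeClass ha σ)
  rw [Finset.sum_congr rfl h2, Finset.sum_const, smul_eq_mul, Finset.card_univ,
    Fintype.card_perm, Fintype.card_fin] at h3
  exact h3.symm

open Classical in
/-- A projection maps a type class to a type class with fibres of equal size. -/
lemma card_fiber_mul_card_typeClass [Fintype α] [Fintype β] {k : α → ℕ} (f : α → β)
    {b : Fin n → β} (hb : b ∈ typeClass (pushCount k f) n) :
    ((typeClass k n).filter fun a => f ∘ a = b).card * (typeClass (pushCount k f) n).card =
      (typeClass k n).card := by
  have h1 : ∀ b' ∈ typeClass (pushCount k f) n,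
      ((typeClass k n).filter fun a => f ∘ a = b').card =
        ((typeClass k n).filter fun a => f ∘ a = b).card := by
    intro b' hb'
    obtain ⟨σ, rfl⟩ := exists_perm_of_mem_typeClass hb hb'
    refine Finset.card_bij' (fun a _ => a ∘ σ.symm) (fun a _ => a ∘ σ) ?_ ?_ ?_ ?_
    · intro a ha
      rw [Finset.mem_filter] at ha ⊢
      refine ⟨comp_perm_mem_typeClass ha.1 _, ?_⟩
      rw [← Function.comp_assoc, ha.2, Function.comp_assoc]
      simp
    · intro a ha
      rw [Finset.mem_filter] at ha ⊢
      exact ⟨comp_perm_mem_typeClass ha.1 _, by rw [← Function.comp_assoc, ha.2]⟩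
    · intro a _
      simp [Function.comp_assoc]
    · intro a _
      simp [Function.comp_assoc]
  have h2 := Finset.card_eq_sum_card_fiberwise (s := typeClass k n)
    (t := typeClass (pushCount k f) n) (f := fun a => f ∘ a)
    (fun a ha => by simpa using comp_mem_typeClass (by simpa using ha) f)
  rw [Finset.sum_congr rfl h1, Finset.sum_const, smul_eq_mul] at h2
  rw [h2, mul_comm]

open Classical in
/-- The number of sequences jointly typical with a given one. -/
lemma card_jointly_typical [Fintype α] [Fintype β] {k : α × β → ℕ} {c : Fin n → β}
    (hc : c ∈ typeClass (pushCount k Prod.snd) n) :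
    ((Finset.univ.filter fun u : Fin n → α => (fun j => (u j, c j)) ∈ typeClass k n).card : ℝ) =
      (typeClass k n).card / (typeClass (pushCount k Prod.snd) n).card := by
  have h := card_fiber_mul_card_typeClass Prod.snd hc
  have hpos : ((typeClass (pushCount k Prod.snd) n).card : ℝ) ≠ 0 := by
    exact_mod_cast (Finset.card_pos.2 ⟨c, hc⟩).ne'
  rw [eq_div_iff hpos, ← h, Nat.cast_mul]
  congr 2
  refine Finset.card_bij' (fun u _ j => (u j, c j)) (fun a _ j => (a j).1) ?_ ?_ ?_ ?_
  · intro u hu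
    rw [Finset.mem_filter] at hu ⊢
    exact ⟨hu.2, rfl⟩
  · intro a ha
    rw [Finset.mem_filter] at ha ⊢
    refine ⟨Finset.mem_univ _, ?_⟩
    rw [← ha.2]
    exact ha.1
  · intro u _
    rfl
  · intro a ha
    rw [Finset.mem_filter] at ha
    rw [← ha.2]
    rfl

end TypeClass

section TypeClassAsymptotics

variable {α : Type*} [Fintype α]

/-- Stirling's formula with a logarithmic error. -/
lemma abs_log_factorial_sub_le (m : ℕ) :
    |Real.log (m.factorial : ℝ) - (m * Real.log m - m)| ≤ 1 + Real.log (m + 1) := by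
  rcases Nat.eq_zero_or_pos m with rfl | hm
  · simp
  have hm' : (0 : ℝ) < m := by exact_mod_cast hm
  have h1 := Stirling.le_log_factorial_stirling hm.ne'
  have h2 : Real.log (Stirling.stirlingSeq m) ≤ Real.log (Stirling.stirlingSeq 1) := by
    obtain ⟨k, rfl⟩ := Nat.exists_eq_succ_of_ne_zero hm.ne'
    exact Stirling.log_stirlingSeq'_antitone (Nat.zero_le k)
  rw [Stirling.log_stirlingSeq_formula, Stirling.stirlingSeq_one,
    Real.log_div hm'.ne' (Real.exp_ne_zero 1), Real.log_div (Real.exp_ne_zero 1) (by positivity),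
    Real.log_exp, Real.log_mul (by norm_num) hm'.ne', Real.log_sqrt (by norm_num)] at h2
  have h3 : 0 < Real.log 2 := Real.log_pos (by norm_num)
  have h4 : 0 ≤ Real.log m := Real.log_nonneg (by exact_mod_cast hm)
  have h5 : Real.log m ≤ Real.log (m + 1) := Real.log_le_log hm' (by linarith)
  have h6 : 0 ≤ Real.log (2 * Real.pi) := Real.log_nonneg (by
    have := Real.pi_gt_three; linarith)
  rw [abs_le]
  constructor <;> linarith

lemma abs_log_card_typeClass_sub_le {n : ℕ} {k : α → ℕ} (hk : ∑ s, k s = n) :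
    |Real.log ((typeClass k n).card : ℝ) - (n * Real.log n - ∑ s, (k s : ℝ) * Real.log (k s))| ≤
      (Fintype.card α + 1) * (1 + Real.log (n + 1)) := by
  have h1 : Real.log ((typeClass k n).card : ℝ) =
      Real.log (n.factorial : ℝ) - ∑ s, Real.log ((k s).factorial : ℝ) := by
    have hc : ((typeClass k n).card : ℝ) ≠ 0 := by
      exact_mod_cast (Finset.card_pos.2 (typeClass_nonempty hk)).ne'
    have hf : ∀ s, ((k s).factorial : ℝ) ≠ 0 := fun s => by
      exact_mod_cast (Nat.factorial_pos _).ne'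
    rw [← card_typeClass_mul_prod_factorial hk, Nat.cast_mul, Nat.cast_prod,
      Real.log_mul hc (Finset.prod_ne_zero_iff.2 fun s _ => hf s),
      Real.log_prod (fun s _ => hf s)]
    ring
  have hkn : (n : ℝ) = ∑ s, (k s : ℝ) := by rw [← hk]; push_cast; rfl
  have h2 : Real.log ((typeClass k n).card : ℝ) -
      (n * Real.log n - ∑ s, (k s : ℝ) * Real.log (k s)) =
      (Real.log (n.factorial : ℝ) - (n * Real.log n - n)) -
      ∑ s, (Real.log ((k s).factorial : ℝ) - ((k s : ℝ) * Real.log (k s) - k s)) := by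
    rw [h1]
    simp only [Finset.sum_sub_distrib]
    rw [← hkn]
    ring
  rw [h2]
  refine (abs_sub _ _).trans ?_
  have h3 := abs_log_factorial_sub_le n
  have h4 : |∑ s, (Real.log ((k s).factorial : ℝ) - ((k s : ℝ) * Real.log (k s) - k s))| ≤
      ∑ _s : α, (1 + Real.log (n + 1)) := by
    refine (Finset.abs_sum_le_sum_abs _ _).trans (Finset.sum_le_sum fun s _ => ?_)
    refine (abs_log_factorial_sub_le (k s)).trans ?_
    have : (k s : ℝ) ≤ n := by
      exact_mod_cast hk ▸ Finset.single_le_sum (fun _ _ => Nat.zero_le _) (Finset.mem_univ s)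
    gcongr
  rw [Finset.sum_const, Finset.card_univ, nsmul_eq_mul] at h4
  linarith

/-- The size of a type class grows exponentially at the rate of the entropy. -/
lemma tendsto_logb_card_typeClass {k : ℕ → α → ℕ} (hk : ∀ n, ∑ s, k n s = n) {q : α → ℝ}
    (hq : ∀ s, Tendsto (fun n : ℕ => (k n s : ℝ) / n) atTop (𝓝 (q s))) :
    Tendsto (fun n : ℕ => (1 / (n : ℝ)) * Real.logb 2 ((typeClass (k n) n).card : ℝ)) atTop
      (𝓝 (-∑ s, q s * Real.logb 2 (q s))) := by
  have hmain : Tendsto (fun n : ℕ => -∑ s, ((k n s : ℝ) / n) * Real.log ((k n s : ℝ) / n)) atTop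
      (𝓝 (-∑ s, q s * Real.log (q s))) :=
    (tendsto_finsetSum _ fun s _ => (Real.continuous_mul_log.tendsto _).comp (hq s)).neg
  have hlog : Tendsto (fun n : ℕ => (Fintype.card α + 1) * (1 + Real.log ((n : ℝ) + 1)) / (n : ℝ))
      atTop (𝓝 0) := by
    have h1 : Tendsto (fun n : ℕ => Real.log ((n : ℝ) + 1) / ((n : ℝ) + 1)) atTop (𝓝 0) :=
      (Real.isLittleO_log_id_atTop.tendsto_div_nhds_zero).comp
        (tendsto_natCast_atTop_atTop.atTop_add tendsto_const_nhds)
    have h2 : Tendsto (fun n : ℕ => ((n : ℝ) + 1) / n) atTop (𝓝 1) := by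
      have h3 : Tendsto (fun n : ℕ => 1 + 1 / (n : ℝ)) atTop (𝓝 (1 + 0)) :=
        tendsto_const_nhds.add tendsto_one_div_atTop_nhds_zero_nat
      rw [add_zero] at h3
      refine h3.congr' ?_
      filter_upwards [eventually_ne_atTop 0] with n hn
      field_simp
    have h4 : Tendsto (fun n : ℕ => Real.log ((n : ℝ) + 1) / (n : ℝ)) atTop (𝓝 (0 * 1)) := by
      refine (h1.mul h2).congr fun n => ?_
      have : (n : ℝ) + 1 ≠ 0 := by positivity
      field_simp
    have h5 := ((tendsto_one_div_atTop_nhds_zero_nat (𝕜 := ℝ)).add h4).const_mul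
      ((Fintype.card α : ℝ) + 1)
    simp only [zero_mul, add_zero, mul_zero] at h5
    refine h5.congr fun n => ?_
    ring
  have hdiff : Tendsto (fun n : ℕ => (1 / (n : ℝ)) * Real.log ((typeClass (k n) n).card : ℝ) -
      -∑ s, ((k n s : ℝ) / n) * Real.log ((k n s : ℝ) / n)) atTop (𝓝 0) := by
    refine squeeze_zero_norm' ?_ hlog
    filter_upwards [eventually_ne_atTop 0] with n hn
    have hn' : (0 : ℝ) < n := by positivity
    have h := abs_log_card_typeClass_sub_le (hk n)
    have hsum : (n : ℝ) = ∑ s, (k n s : ℝ) := by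
      conv_lhs => rw [← hk n]
      push_cast
      rfl
    have e : ∀ s, ((k n s : ℝ) / n) * Real.log ((k n s : ℝ) / n) =
        (1 / (n : ℝ)) * ((k n s : ℝ) * Real.log (k n s) - (k n s : ℝ) * Real.log n) := by
      intro s
      rcases eq_or_ne (k n s : ℝ) 0 with h0 | h0
      · simp [h0]
      · rw [Real.log_div h0 hn'.ne']
        ring
    simp only [e]
    rw [← Finset.mul_sum, Finset.sum_sub_distrib, ← Finset.sum_mul, ← hsum, Real.norm_eq_abs,
      show (1 / (n : ℝ)) * Real.log ((typeClass (k n) n).card : ℝ) -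
        -((1 / (n : ℝ)) * (∑ s, (k n s : ℝ) * Real.log (k n s) - n * Real.log n)) =
        (Real.log ((typeClass (k n) n).card : ℝ) -
          (n * Real.log n - ∑ s, (k n s : ℝ) * Real.log (k n s))) / n by ring,
      abs_div, abs_of_pos hn']
    gcongr
  have := (hdiff.add hmain).div_const (Real.log 2)
  simp only [sub_add_cancel, zero_add] at this
  refine (this.congr fun n => ?_).trans_eq ?_
  · simp only [Real.logb]; ring
  · congr 1
    rw [neg_div, Finset.sum_div]
    simp only [Real.logb, mul_div_assoc]

lemma tendsto_logb_card_typeClass_push {β : Type*} [Fintype β] {k : ℕ → α → ℕ}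
    (hk : ∀ n, ∑ s, k n s = n) {q : α → ℝ}
    (hq : ∀ s, Tendsto (fun n : ℕ => (k n s : ℝ) / n) atTop (𝓝 (q s))) (f : α → β) :
    Tendsto (fun n : ℕ => (1 / (n : ℝ)) *
      Real.logb 2 ((typeClass (pushCount (k n) f) n).card : ℝ)) atTop (𝓝 (entropy q f)) := by
  refine tendsto_logb_card_typeClass (fun n => (sum_pushCount _ _).trans (hk n)) fun b => ?_
  unfold law pushCount
  push_cast
  simp only [Finset.sum_div]
  exact tendsto_finsetSum _ fun s _ => hq s

end TypeClassAsymptotics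

/-! ### Achievability -/

section Rounding

/-- Every distribution is a limit of types supported in its support on which a given cost has no
larger mean: round down everywhere except at the cheapest letter of the support. -/
lemma exists_types_tendsto {Ω : Type*} [Fintype Ω] {Q : Ω → ℝ} (hQ : Q ∈ stdSimplex ℝ Ω)
    (c : Ω → ℝ) :
    ∃ k : ℕ → Ω → ℕ, (∀ n, ∑ s, k n s = n) ∧
      (∀ s, Tendsto (fun n : ℕ => (k n s : ℝ) / n) atTop (𝓝 (Q s))) ∧
      (∀ n s, Q s = 0 → k n s = 0) ∧ ∀ n, ∑ s, (k n s : ℝ) * c s ≤ n * ∑ s, Q s * c s := by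
  classical
  have hne : (Finset.univ.filter fun s => Q s ≠ 0).Nonempty := by
    by_contra h
    rw [Finset.not_nonempty_iff_eq_empty, Finset.filter_eq_empty_iff] at h
    have h1 : ∀ s, Q s = 0 := fun s => not_not.1 (h (Finset.mem_univ s))
    have h2 := hQ.2
    simp [h1] at h2
  obtain ⟨s₀, hs₀, hmin⟩ := Finset.exists_min_image _ c hne
  have hs₀' : Q s₀ ≠ 0 := by simpa using hs₀
  let f : ℕ → Ω → ℕ := fun n s => ⌊Q s * n⌋₊
  have hf : ∀ n s, (f n s : ℝ) ≤ Q s * n := fun n s =>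
    Nat.floor_le (mul_nonneg (hQ.1 s) (Nat.cast_nonneg n))
  have hQsum : Q s₀ + ∑ s ∈ Finset.univ.erase s₀, Q s = 1 := by
    rw [Finset.add_sum_erase _ _ (Finset.mem_univ s₀), hQ.2]
  have hle : ∀ n, ∑ s ∈ Finset.univ.erase s₀, f n s ≤ n := by
    intro n
    have h1 : ∑ s ∈ Finset.univ.erase s₀, (f n s : ℝ) ≤ n := by
      refine (Finset.sum_le_sum fun s _ => hf n s).trans ?_
      rw [← Finset.sum_mul]
      have := hQ.1 s₀
      have : (0 : ℝ) ≤ n := Nat.cast_nonneg n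
      nlinarith
    exact_mod_cast h1
  let k : ℕ → Ω → ℕ := fun n s =>
    if s = s₀ then n - ∑ s ∈ Finset.univ.erase s₀, f n s else f n s
  have hk₀ : ∀ n, (k n s₀ : ℝ) = n - ∑ s ∈ Finset.univ.erase s₀, (f n s : ℝ) := by
    intro n
    simp only [k, if_true]
    rw [Nat.cast_sub (hle n)]
    push_cast
    rfl
  have hk : ∀ n, ∀ s ∈ Finset.univ.erase s₀, k n s = f n s := by
    intro n s hs
    simp [k, Finset.ne_of_mem_erase hs]
  have hlim : ∀ s, Tendsto (fun n : ℕ => (f n s : ℝ) / n) atTop (𝓝 (Q s)) := fun s =>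
    (tendsto_nat_floor_mul_div_atTop (hQ.1 s)).comp tendsto_natCast_atTop_atTop
  refine ⟨k, ?_, ?_, ?_, ?_⟩
  · intro n
    rw [← Finset.add_sum_erase _ _ (Finset.mem_univ s₀), Finset.sum_congr rfl (hk n)]
    simp only [k, if_true]
    exact Nat.sub_add_cancel (hle n)
  · intro s
    by_cases hs : s = s₀
    · subst hs
      have h1 : Tendsto (fun n : ℕ => 1 - ∑ s' ∈ Finset.univ.erase s, (f n s' : ℝ) / n) atTop
          (𝓝 (1 - ∑ s' ∈ Finset.univ.erase s, Q s')) :=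
        tendsto_const_nhds.sub (tendsto_finsetSum _ fun s' _ => hlim s')
      rw [← hQsum, add_sub_cancel_right] at h1
      refine h1.congr' ?_
      filter_upwards [eventually_ne_atTop 0] with n hn
      have hn' : (n : ℝ) ≠ 0 := by exact_mod_cast hn
      rw [hk₀, sub_div, div_self hn', Finset.sum_div, hQsum]
    · refine (hlim s).congr fun n => ?_
      rw [hk n s (Finset.mem_erase.2 ⟨hs, Finset.mem_univ s⟩)]
  · intro n s hs
    have : s ≠ s₀ := fun h => hs₀' (h ▸ hs)
    simp [k, this, f, hs]
  · intro n
    rw [← Finset.add_sum_erase _ _ (Finset.mem_univ s₀),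
      ← Finset.add_sum_erase _ (fun s => Q s * c s) (Finset.mem_univ s₀), hk₀]
    have h1 : ∑ s ∈ Finset.univ.erase s₀, (k n s : ℝ) * (c s - c s₀) ≤
        ∑ s ∈ Finset.univ.erase s₀, (n * Q s) * (c s - c s₀) := by
      refine Finset.sum_le_sum fun s hs => ?_
      rw [hk n s hs]
      by_cases h0 : Q s = 0
      · simp [f, h0]
      · have h2 := hmin s (by simpa using h0)
        have h3 := hf n s
        nlinarith
    simp only [mul_sub, Finset.sum_sub_distrib, ← Finset.sum_mul, mul_assoc,
      ← Finset.mul_sum] at h1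
    have hfk : ∑ s ∈ Finset.univ.erase s₀, (f n s : ℝ) =
        ∑ s ∈ Finset.univ.erase s₀, (k n s : ℝ) :=
      Finset.sum_congr rfl fun s hs => by rw [hk n s hs]
    rw [hfk]
    have h4 : Q s₀ = 1 - ∑ s ∈ Finset.univ.erase s₀, Q s := by linarith
    rw [h4]
    linarith

end Rounding

section TypeCoding

variable {X Y Z : Type*} [Fintype X] [Fintype Y] [Fintype Z]

/-- The sequences with the letter counts that the joint letter counts `k` induce on `f`. -/
abbrev typical {Ω β : Type*} [Fintype Ω] [Fintype β] (k : Ω → ℕ) (f : Ω → β) (n : ℕ) :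
    Finset (Fin n → β) := typeClass (pushCount k f) n

lemma comp_mem_typical {Ω β γ : Type*} [Fintype Ω] [Fintype β] [Fintype γ] {k : Ω → ℕ} {f : Ω → β}
    {n : ℕ} {a : Fin n → β} (h : a ∈ typical k f n) (g : β → γ) :
    g ∘ a ∈ typical k (g ∘ f) n := by
  have := comp_mem_typeClass h g
  rwa [pushCount_pushCount] at this

lemma card_jointly_typical_of_iff {Ω β γ : Type*} [Fintype Ω] [Fintype β] [Fintype γ] {k : Ω → ℕ}
    (f : Ω → β) (g : Ω → γ) {n : ℕ} {c : Fin n → γ} (hc : c ∈ typical k g n)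
    {p : (Fin n → β) → Prop} [DecidablePred p]
    (hp : ∀ u, p u ↔ (fun j => (u j, c j)) ∈ typical k (fun ω => (f ω, g ω)) n) :
    (({u | p u} : Finset (Fin n → β)).card : ℝ) =
      (typical k (fun ω => (f ω, g ω)) n).card / (typical k g n).card := by
  have h : pushCount (pushCount k fun ω => (f ω, g ω)) Prod.snd = pushCount k g :=
    pushCount_pushCount _ _ _
  have h1 := card_jointly_typical (k := pushCount k fun ω => (f ω, g ω)) (c := c)
    (by rw [h]; exact hc)
  rw [h] at h1
  rw [← h1]
  congr 2
  ext u
  simp [hp]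

lemma card_typical_subtype_of_iff {Ω β γ : Type*} [Fintype Ω] [Fintype β] [Fintype γ] {k : Ω → ℕ}
    (f : Ω → β) (g : Ω → γ) {n : ℕ} {c : Fin n → γ} (hc : c ∈ typical k g n)
    {p : {u // u ∈ typical k f n} → Prop} [DecidablePred p]
    (hp : ∀ u, p u ↔ (fun j => (u.1 j, c j)) ∈ typical k (fun ω => (f ω, g ω)) n) :
    (({u | p u} : Finset {u // u ∈ typical k f n}).card : ℝ) =
      (typical k (fun ω => (f ω, g ω)) n).card / (typical k g n).card := by
  classical
  rw [← card_jointly_typical_of_iff f g hc (p := fun u => (fun j => (u j, c j)) ∈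
    typical k (fun ω => (f ω, g ω)) n) fun u => Iff.rfl,
    ← Finset.card_map (Function.Embedding.subtype _)]
  congr 2
  ext v
  simp only [Finset.mem_map, Finset.mem_filter, Finset.mem_univ, true_and,
    Function.Embedding.subtype_apply]
  constructor
  · rintro ⟨u, hu, rfl⟩
    exact (hp u).1 hu
  · exact fun hv => ⟨⟨v, comp_mem_typical hv Prod.fst⟩, (hp _).2 hv, rfl⟩

lemma typical_card_pos {Ω β : Type*} [Fintype Ω] [Fintype β] {k : Ω → ℕ} {n : ℕ}
    (hk : ∑ s, k s = n) (f : Ω → β) : (0 : ℝ) < (typical k f n).card := by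
  exact_mod_cast Finset.card_pos.2 (typeClass_nonempty ((sum_pushCount k f).trans hk))

lemma blockLaw_eq_of_typical {P : X × Y → ℝ} (hP : ∀ a, 0 ≤ P a) {k : Quad X Y Z → ℕ} {n : ℕ}
    (hac : ∀ ω, P (rvX ω, rvY ω) = 0 → k ω = 0) {x : Fin n → X} {y : Fin n → Y}
    (h : (fun j => (x j, y j)) ∈ typical k (fun ω => (rvX ω, rvY ω)) n) :
    blockLaw P n (x, y) = (2 : ℝ) ^ (∑ ω, (k ω : ℝ) * Real.logb 2 (P (rvX ω, rvY ω))) := by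
  classical
  have hpos : ∀ j, P (x j, y j) ≠ 0 := by
    intro j hj
    rw [typical, mem_typeClass] at h
    have h1 := h (x j, y j)
    have h2 : pushCount k (fun ω => (rvX ω, rvY ω)) (x j, y j) = 0 := by
      unfold pushCount
      refine Finset.sum_eq_zero fun ω hω => hac ω ?_
      have : (rvX ω, rvY ω) = (x j, y j) := by simpa using hω
      rw [this, hj]
    rw [h2, Fintype.card_eq_zero_iff] at h1
    exact h1.elim ⟨j, rfl⟩
  have hb : blockLaw P n (x, y) ≠ 0 := Finset.prod_ne_zero_iff.2 fun j _ => hpos j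
  have hb' : 0 < blockLaw P n (x, y) :=
    lt_of_le_of_ne (Finset.prod_nonneg fun j _ => hP _) (Ne.symm hb)
  rw [← Real.rpow_logb (b := 2) (by norm_num) (by norm_num) hb', logb_blockLaw hb]
  congr 1
  have h1 := sum_comp_of_mem_typeClass h fun a => Real.logb 2 (P a)
  rw [h1]
  simp only [nsmul_eq_mul, pushCount, Nat.cast_sum, Finset.sum_mul]
  rw [← Finset.sum_fiberwise Finset.univ (fun ω : Quad X Y Z => (rvX ω, rvY ω))]
  refine Finset.sum_congr rfl fun a _ => Finset.sum_congr (by congr) fun ω hω => ?_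
  have : (rvX ω, rvY ω) = a := by simpa using hω
  rw [this]

end TypeCoding

section Achievability

variable {X Y Z : Type*} [Fintype X] [Fintype Y]

lemma sum_blockLaw_le_nonExcessProb {P : X × Y → ℝ} (hP : P ∈ stdSimplex ℝ (X × Y))
    {d : X → Y → Z → ℝ} {D : ℝ} {n : ℕ} {Φ : Code X Y Z n}
    (G : Finset ((Fin n → X) × (Fin n → Y))) (hG : ∀ xy ∈ G, GoodBlock d D Φ xy) :
    ∑ xy ∈ G, blockLaw P n xy ≤ nonExcessProb P d D Φ := by
  classical
  rw [nonExcessProb_eq hP]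
  refine Finset.sum_le_sum_of_subset_of_nonneg ?_ fun xy _ _ => blockLaw_nonneg hP xy
  intro xy h
  simpa using hG xy h

/-- The number `N` of codewords is chosen so that about half a wrong codeword is expected to be
compatible with the source block, the number `M` of bins as large as the rate permits. -/
lemma exists_codebook_size {px py r : ℝ} (px0 : 0 < px) (py0 : 0 < py) (hr : 0 ≤ r) :
    ∃ N M : ℕ, 1 ≤ M ∧ (M : ℝ) ≤ (2 : ℝ) ^ r ∧ ((N : ℝ) - 1) * px ≤ 1 / 2 ∧
      ∀ c : ℝ, 0 ≤ c → c / (16 * max px (py * (2 : ℝ) ^ (-r))) ≤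
        N * c / (4 * (1 + N * py / M)) := by
  set N : ℕ := ⌈1 / (2 * px)⌉₊
  have hN1 : 1 / (2 * px) ≤ N := Nat.le_ceil _
  have hN2 : ((N : ℝ) - 1) * px ≤ 1 / 2 := by
    have h1 : (N : ℝ) < 1 / (2 * px) + 1 := Nat.ceil_lt_add_one (by positivity)
    have h2 : ((N : ℝ) - 1) * px ≤ 1 / (2 * px) * px :=
      mul_le_mul_of_nonneg_right (by linarith) px0.le
    have h3 : 1 / (2 * px) * px = 1 / 2 := by field_simp
    linarith
  set M : ℕ := ⌊(2 : ℝ) ^ r⌋₊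
  have hone : (1 : ℝ) ≤ (2 : ℝ) ^ r := Real.one_le_rpow (by norm_num) hr
  have hM1 : 1 ≤ M := Nat.le_floor (by simpa using hone)
  have hM1' : (1 : ℝ) ≤ M := by exact_mod_cast hM1
  have hM2 : (M : ℝ) ≤ (2 : ℝ) ^ r := Nat.floor_le (by positivity)
  have hM3 : (2 : ℝ) ^ r ≤ 2 * M := by
    have : (2 : ℝ) ^ r < M + 1 := Nat.lt_floor_add_one _
    linarith
  refine ⟨N, M, hM1, hM2, hN2, fun c hc => ?_⟩
  set m := max px (py * (2 : ℝ) ^ (-r))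
  have hm0 : 0 < m := lt_max_of_lt_left px0
  have hNpos : (0 : ℝ) < N := lt_of_lt_of_le (by positivity) hN1
  have h1 : py / M ≤ 2 * m := by
    have h2 : py * (2 : ℝ) ^ (-r) ≤ m := le_max_right _ _
    rw [Real.rpow_neg (by norm_num), ← div_eq_mul_inv, div_le_iff₀ (by positivity)] at h2
    rw [div_le_iff₀ (by linarith)]
    nlinarith
  have h3 : px ≤ m := le_max_left _ _
  have h4 : 1 ≤ N * (2 * px) := by
    rwa [div_le_iff₀ (by positivity)] at hN1
  rw [div_le_div_iff₀ (by positivity) (by positivity)]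
  have h5 : 1 + N * py / M ≤ 4 * (N * m) := by
    rw [mul_div_assoc]
    have h6 : (N : ℝ) * (py / M) ≤ N * (2 * m) := mul_le_mul_of_nonneg_left h1 hNpos.le
    have h7 : (N : ℝ) * (2 * px) ≤ N * (2 * m) :=
      mul_le_mul_of_nonneg_left (by linarith) hNpos.le
    linarith
  have h8 := mul_le_mul_of_nonneg_left h5 (show 0 ≤ c * 4 by positivity)
  linarith

/-- Random coding for the joint letter counts `k`: the codewords are uniform on the type class of
`Ũ`, and the reproduction is uniform given the codeword and the side information. Here `px`, `py`
and `pxy` are the probabilities that a codeword is jointly typical with a given `x^n`, `y^n` and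
`(x^n, y^n)`, and `q` is the probability that a reproduction drawn from a jointly typical codeword
and side information is jointly typical with the source block too. -/
lemma exists_code_of_type [Fintype Z] {P : X × Y → ℝ} (hP : P ∈ stdSimplex ℝ (X × Y))
    (d : X → Y → Z → ℝ) {R D : ℝ} (hR : 0 ≤ R) {n : ℕ} (hn : n ≠ 0)
    {k : Quad X Y Z → ℕ} (hk : ∑ ω, k ω = n)
    (hac : ∀ ω, P (rvX ω, rvY ω) = 0 → k ω = 0)
    (hd : ∑ ω, (k ω : ℝ) * d (rvX ω) (rvY ω) (rvZ ω) ≤ n * D) {px py pxy q : ℝ}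
    (hpx : px = (typical k (fun ω => (rvU ω, rvX ω)) n).card /
      ((typical k rvX n).card * (typical k rvU n).card))
    (hpy : py = (typical k (fun ω => (rvU ω, rvY ω)) n).card /
      ((typical k rvY n).card * (typical k rvU n).card))
    (hpxy : pxy = (typical k (fun ω => (rvU ω, rvX ω, rvY ω)) n).card /
      ((typical k (fun ω => (rvX ω, rvY ω)) n).card * (typical k rvU n).card))
    (hq : q = (typical k (fun ω => (rvZ ω, rvU ω, rvX ω, rvY ω)) n).card /
      (typical k (fun ω => (rvU ω, rvX ω, rvY ω)) n).card *
      ((typical k (fun ω => (rvU ω, rvY ω)) n).card /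
      (typical k (fun ω => (rvZ ω, rvU ω, rvY ω)) n).card)) :
    ∃ Φ : Code X Y Z n, (1 / (n : ℝ)) * Real.logb 2 (Φ.card : ℝ) ≤ R ∧
      (2 : ℝ) ^ (∑ ω, (k ω : ℝ) * Real.logb 2 (P (rvX ω, rvY ω))) *
        (typical k (fun ω => (rvX ω, rvY ω)) n).card * (pxy * q) /
        (16 * max px (py * (2 : ℝ) ^ (-(n * R)))) ≤ nonExcessProb P d D Φ := by
  classical
  have hn' : (0 : ℝ) < n := by positivity
  -- positivity of all the constants
  have cU := typical_card_pos hk (rvU : Quad X Y Z → Aux X Y Z)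
  have cX := typical_card_pos hk (rvX : Quad X Y Z → X)
  have cY := typical_card_pos hk (rvY : Quad X Y Z → Y)
  have cUX := typical_card_pos hk (fun ω : Quad X Y Z => (rvU ω, rvX ω))
  have cUY := typical_card_pos hk (fun ω : Quad X Y Z => (rvU ω, rvY ω))
  have cXY := typical_card_pos hk (fun ω : Quad X Y Z => (rvX ω, rvY ω))
  have cUXY := typical_card_pos hk (fun ω : Quad X Y Z => (rvU ω, rvX ω, rvY ω))
  have cZUY := typical_card_pos hk (fun ω : Quad X Y Z => (rvZ ω, rvU ω, rvY ω))
  have cZUXY := typical_card_pos hk (fun ω : Quad X Y Z => (rvZ ω, rvU ω, rvX ω, rvY ω))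
  have px0 : 0 < px := by rw [hpx]; positivity
  have py0 : 0 < py := by rw [hpy]; positivity
  have pxy0 : 0 < pxy := by rw [hpxy]; positivity
  have q0 : 0 < q := by rw [hq]; positivity
  have hZ : Nonempty Z := by
    by_contra h
    rw [not_nonempty_iff] at h
    simp at hk
    exact hn hk.symm
  -- The predicates are introduced through their characterizations only, which keeps the
  -- definition of `typical` from being unfolded.
  let T := typical k (rvU : Quad X Y Z → Aux X Y Z) n
  let V := {u // u ∈ T}
  have hV : Nonempty V := by
    obtain ⟨u, hu⟩ := typeClass_nonempty ((sum_pushCount k (rvU : Quad X Y Z → Aux X Y Z)).trans hk)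
    exact ⟨⟨u, hu⟩⟩
  have hVcard : (Fintype.card V : ℝ) = (typical k (rvU : Quad X Y Z → Aux X Y Z) n).card := by
    simp [V, T]
  obtain ⟨a, ha'⟩ : ∃ a : V → (Fin n → X) → Prop, ∀ u x, a u x ↔
      (fun j => (u.1 j, x j)) ∈ typical k (fun ω => (rvU ω, rvX ω)) n := ⟨_, fun _ _ => Iff.rfl⟩
  obtain ⟨b, hb'⟩ : ∃ b : V → (Fin n → Y) → Prop, ∀ u y, b u y ↔
      (fun j => (u.1 j, y j)) ∈ typical k (fun ω => (rvU ω, rvY ω)) n := ⟨_, fun _ _ => Iff.rfl⟩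
  obtain ⟨t, ht'⟩ : ∃ t : V → (Fin n → X) → (Fin n → Y) → Prop, ∀ u x y, t u x y ↔
      (fun j => (u.1 j, x j, y j)) ∈ typical k (fun ω => (rvU ω, rvX ω, rvY ω)) n :=
    ⟨_, fun _ _ _ => Iff.rfl⟩
  obtain ⟨good, hgood'⟩ : ∃ good : (Fin n → X) → (Fin n → Y) → (Fin n → Z) → Prop,
      ∀ x y z, good x y z ↔ (1 / (n : ℝ)) * blockDistortion d x y z ≤ D :=
    ⟨_, fun _ _ _ => Iff.rfl⟩
  let κ : V → (Fin n → Y) → (Fin n → Z) → ℝ := fun u y z =>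
    if (fun j => (z j, u.1 j, y j)) ∈ typical k (fun ω => (rvZ ω, rvU ω, rvY ω)) n then
      (typical k (fun ω => (rvU ω, rvY ω)) n).card /
        (typical k (fun ω => (rvZ ω, rvU ω, rvY ω)) n).card else 0
  let S : Finset ((Fin n → X) × (Fin n → Y)) :=
    {xy | (fun j => (xy.1 j, xy.2 j)) ∈ typical k (fun ω => (rvX ω, rvY ω)) n}
  have hS : ∀ xy, xy ∈ S ↔
      (fun j => (xy.1 j, xy.2 j)) ∈ typical k (fun ω => (rvX ω, rvY ω)) n := by
    intro xy; simp [S]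
  have hScard : (S.card : ℝ) = (typical k (fun ω => (rvX ω, rvY ω)) n).card := by
    congr 1
    refine Finset.card_bij' (fun xy _ j => (xy.1 j, xy.2 j))
      (fun c _ => (fun j => (c j).1, fun j => (c j).2)) ?_ ?_ ?_ ?_
    · exact fun xy h => (hS xy).1 h
    · exact fun c h => (hS _).2 h
    · intro xy _; rfl
    · intro c _; rfl
  have hκ0 : ∀ u y z, 0 ≤ κ u y z := by
    intro u y z
    simp only [κ]
    split_ifs <;> positivity
  have hκ1 : ∀ u y, ∑ z, κ u y z ≤ 1 := by
    intro u y
    simp only [κ]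
    rw [← Finset.sum_filter, Finset.sum_const, nsmul_eq_mul]
    by_cases hb : b u y
    · rw [card_jointly_typical_of_iff (rvZ : Quad X Y Z → Z) (fun ω => (rvU ω, rvY ω))
        ((hb' u y).1 hb) fun z => Iff.rfl]
      rw [div_mul_div_cancel₀ cUY.ne', div_self cZUY.ne']
    · rw [Finset.filter_eq_empty_iff.2]
      · simp
      · exact fun z _ hz => hb ((hb' u y).2 (comp_mem_typical hz Prod.snd))
  have hta : ∀ u x y, t u x y → a u x := fun u x y h =>
    (ha' u x).2 (comp_mem_typical ((ht' u x y).1 h) fun s => (s.1, s.2.1))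
  have htb : ∀ u x y, t u x y → b u y := fun u x y h =>
    (hb' u y).2 (comp_mem_typical ((ht' u x y).1 h) fun s => (s.1, s.2.2))
  have hgood : ∀ u x y, t u x y → q ≤ ∑ z with good x y z, κ u y z := by
    intro u x y h
    have hc := card_jointly_typical_of_iff (rvZ : Quad X Y Z → Z)
      (fun ω => (rvU ω, rvX ω, rvY ω)) ((ht' u x y).1 h) fun z => Iff.rfl
    rw [hq, ← hc, ← nsmul_eq_mul, ← Finset.sum_const]
    refine (Finset.sum_le_sum (g := κ u y) fun z hz => ?_).trans
      (Finset.sum_le_sum_of_subset_of_nonneg ?_ fun z _ _ => hκ0 _ _ _)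
    · have hz' := (Finset.mem_filter.1 hz).2
      have hz'' : (fun j => (z j, u.1 j, y j)) ∈ typical k (fun ω => (rvZ ω, rvU ω, rvY ω)) n :=
        comp_mem_typical hz' fun s => (s.1, s.2.1, s.2.2.2)
      simp only [κ]
      rw [if_pos hz'']
    · intro z hz
      have hz' := (Finset.mem_filter.1 hz).2
      rw [Finset.mem_filter]
      refine ⟨Finset.mem_univ z, ?_⟩
      have h1 := sum_comp_of_mem_typeClass hz' fun s => d s.2.2.1 s.2.2.2 s.1
      have h2 : ∑ s, pushCount k (fun ω => (rvZ ω, rvU ω, rvX ω, rvY ω)) s •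
          d s.2.2.1 s.2.2.2 s.1 = ∑ ω, (k ω : ℝ) * d (rvX ω) (rvY ω) (rvZ ω) := by
        have := sum_law_mul (fun ω => (k ω : ℝ))
          (fun ω : Quad X Y Z => (rvZ ω, rvU ω, rvX ω, rvY ω)) fun s => d s.2.2.1 s.2.2.2 s.1
        rw [← this]
        refine Finset.sum_congr rfl fun s _ => ?_
        rw [nsmul_eq_mul]
        unfold pushCount law
        push_cast
        rfl
      rw [h2] at h1
      rw [hgood', blockDistortion, h1, one_div, inv_mul_le_iff₀ hn']
      exact hd
  have hxmem : ∀ xy ∈ S, xy.1 ∈ typical k (rvX : Quad X Y Z → X) n := fun xy h =>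
    comp_mem_typical ((hS xy).1 h) Prod.fst
  have hymem : ∀ xy ∈ S, xy.2 ∈ typical k (rvY : Quad X Y Z → Y) n := fun xy h =>
    comp_mem_typical ((hS xy).1 h) Prod.snd
  have cancel : ∀ v w : ℝ, v / (w * (typical k (rvU : Quad X Y Z → Aux X Y Z) n).card) *
      (typical k (rvU : Quad X Y Z → Aux X Y Z) n).card = v / w := fun v w => by
    rw [← div_div, div_mul_cancel₀ _ cU.ne']
  have ha : ∀ xy ∈ S, (({u | a u xy.1} : Finset V).card : ℝ) = px * Fintype.card V := by
    intro xy h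
    rw [hVcard, hpx, card_typical_subtype_of_iff rvU rvX (hxmem xy h) fun u =>
      ha' u _]
    exact (cancel _ _).symm
  have hb : ∀ xy ∈ S, (({u | b u xy.2} : Finset V).card : ℝ) = py * Fintype.card V := by
    intro xy h
    rw [hVcard, hpy, card_typical_subtype_of_iff rvU rvY (hymem xy h) fun u =>
      hb' u _]
    exact (cancel _ _).symm
  have ht : ∀ xy ∈ S, (({u | t u xy.1 xy.2} : Finset V).card : ℝ) = pxy * Fintype.card V := by
    intro xy h
    rw [hVcard, hpxy, card_typical_subtype_of_iff rvU (fun ω => (rvX ω, rvY ω)) ((hS xy).1 h)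
      fun u => ht' u _ _]
    exact (cancel _ _).symm
  obtain ⟨N, M, hM1, hM2, hN, hNM⟩ := exists_codebook_size px0 py0 (r := n * R) (by positivity)
  have hM0 : NeZero M := ⟨by omega⟩
  obtain ⟨enc, dec, hcount⟩ := exists_code_of_random (M := M) (N := N) S hκ0 hκ1 hta htb q0.le
    hgood py0.le pxy0.le ha hb ht hN
  refine ⟨⟨M, enc, dec⟩, ?_, ?_⟩
  · rw [one_div, inv_mul_le_iff₀ hn',
      Real.logb_le_iff_le_rpow (by norm_num) (by exact_mod_cast hM1)]
    exact hM2
  · refine le_trans ?_ (sum_blockLaw_le_nonExcessProb hP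
      {xy ∈ S | good xy.1 xy.2 (dec (enc xy.1) xy.2)} fun xy h =>
        (hgood' _ _ _).1 (Finset.mem_filter.1 h).2)
    rw [Finset.sum_congr rfl fun xy h => blockLaw_eq_of_typical hP.1 hac
      ((hS xy).1 (Finset.mem_filter.1 h).1), Finset.sum_const, nsmul_eq_mul]
    set w : ℝ := (2 : ℝ) ^ (∑ ω, (k ω : ℝ) * Real.logb 2 (P (rvX ω, rvY ω)))
    have hw : 0 ≤ w := by positivity
    rw [mul_comm _ w, mul_assoc, mul_div_assoc]
    refine mul_le_mul_of_nonneg_left (le_trans ?_ hcount) hw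
    rw [hScard, mul_div_assoc, mul_assoc (N : ℝ)]
    exact mul_le_mul_of_nonneg_left (hNM _ (by positivity)) cXY.le

/-- The exponent of the random code of `exists_code_of_type` in terms of the normalized logarithms
of the sizes of the type classes; the `4` is the logarithm of the constant `16`. -/
lemma blockExponent_le_of_type [Fintype Z] {P : X × Y → ℝ} (hP : P ∈ stdSimplex ℝ (X × Y))
    (d : X → Y → Z → ℝ) {R D : ℝ} (hR : 0 ≤ R) {n : ℕ} (hn : n ≠ 0)
    {k : Quad X Y Z → ℕ} (hk : ∑ ω, k ω = n)
    (hac : ∀ ω, P (rvX ω, rvY ω) = 0 → k ω = 0)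
    (hd : ∑ ω, (k ω : ℝ) * d (rvX ω) (rvY ω) (rvZ ω) ≤ n * D) {L hX hY hUX hUY hZUY hZUXY : ℝ}
    (eL : L = (1 / (n : ℝ)) * ∑ ω, (k ω : ℝ) * Real.logb 2 (P (rvX ω, rvY ω)))
    (eX : hX = (1 / (n : ℝ)) * Real.logb 2 (typical k rvX n).card)
    (eY : hY = (1 / (n : ℝ)) * Real.logb 2 (typical k rvY n).card)
    (eUX : hUX = (1 / (n : ℝ)) * Real.logb 2 (typical k (fun ω => (rvU ω, rvX ω)) n).card)
    (eUY : hUY = (1 / (n : ℝ)) * Real.logb 2 (typical k (fun ω => (rvU ω, rvY ω)) n).card)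
    (eZUY : hZUY =
      (1 / (n : ℝ)) * Real.logb 2 (typical k (fun ω => (rvZ ω, rvU ω, rvY ω)) n).card)
    (eZUXY : hZUXY =
      (1 / (n : ℝ)) * Real.logb 2 (typical k (fun ω => (rvZ ω, rvU ω, rvX ω, rvY ω)) n).card) :
    blockExponent P d R D n ≤
      ((4 * (1 / (n : ℝ)) + (hZUY - hZUXY - hUY - L) + max (hUX - hX) (hUY - hY - R) : ℝ) :
        EReal) := by
  have hn' : (0 : ℝ) < n := by positivity
  obtain ⟨Φ, hΦ, hp⟩ := exists_code_of_type hP d hR hn hk hac hd rfl rfl rfl rfl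
  have cU := typical_card_pos hk (rvU : Quad X Y Z → Aux X Y Z)
  have cX := typical_card_pos hk (rvX : Quad X Y Z → X)
  have cY := typical_card_pos hk (rvY : Quad X Y Z → Y)
  have cUX := typical_card_pos hk (fun ω : Quad X Y Z => (rvU ω, rvX ω))
  have cUY := typical_card_pos hk (fun ω : Quad X Y Z => (rvU ω, rvY ω))
  have cXY := typical_card_pos hk (fun ω : Quad X Y Z => (rvX ω, rvY ω))
  have cUXY := typical_card_pos hk (fun ω : Quad X Y Z => (rvU ω, rvX ω, rvY ω))
  have cZUY := typical_card_pos hk (fun ω : Quad X Y Z => (rvZ ω, rvU ω, rvY ω))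
  have cZUXY := typical_card_pos hk (fun ω : Quad X Y Z => (rvZ ω, rvU ω, rvX ω, rvY ω))
  generalize ((typical k (rvU : Quad X Y Z → Aux X Y Z) n).card : ℝ) = tU at *
  generalize ((typical k (rvX : Quad X Y Z → X) n).card : ℝ) = tX at *
  generalize ((typical k (rvY : Quad X Y Z → Y) n).card : ℝ) = tY at *
  generalize ((typical k (fun ω : Quad X Y Z => (rvU ω, rvX ω)) n).card : ℝ) = tUX at *
  generalize ((typical k (fun ω : Quad X Y Z => (rvU ω, rvY ω)) n).card : ℝ) = tUY at *
  generalize ((typical k (fun ω : Quad X Y Z => (rvX ω, rvY ω)) n).card : ℝ) = tXY at *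
  generalize ((typical k (fun ω : Quad X Y Z => (rvU ω, rvX ω, rvY ω)) n).card : ℝ) = tUXY at *
  generalize ((typical k (fun ω : Quad X Y Z => (rvZ ω, rvU ω, rvY ω)) n).card : ℝ) = tZUY at *
  generalize ((typical k (fun ω : Quad X Y Z => (rvZ ω, rvU ω, rvX ω, rvY ω)) n).card : ℝ) =
    tZUXY at *
  generalize ∑ ω, (k ω : ℝ) * Real.logb 2 (P (rvX ω, rvY ω)) = l at *
  refine (iInf_le _ ⟨Φ, hΦ⟩).trans ?_
  set m := max (tUX / (tX * tU)) (tUY / (tY * tU) * (2 : ℝ) ^ (-(n * R))) with hm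
  have hm0 : 0 < m := lt_max_of_lt_left (by positivity)
  have hp0 : 0 < nonExcessProb P d D Φ := lt_of_lt_of_le (by positivity) hp
  have hlogm : Real.logb 2 m = max (Real.logb 2 tUX - Real.logb 2 tX)
      (Real.logb 2 tUY - Real.logb 2 tY - n * R) - Real.logb 2 tU := by
    have e1 : Real.logb 2 (tUX / (tX * tU)) =
        Real.logb 2 tUX - Real.logb 2 tX - Real.logb 2 tU := by
      rw [Real.logb_div cUX.ne' (by positivity), Real.logb_mul cX.ne' cU.ne']; ring
    have e2 : Real.logb 2 (tUY / (tY * tU) * (2 : ℝ) ^ (-(n * R))) =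
        Real.logb 2 tUY - Real.logb 2 tY - n * R - Real.logb 2 tU := by
      rw [Real.logb_mul (by positivity) (by positivity),
        Real.logb_div cUY.ne' (by positivity), Real.logb_mul cY.ne' cU.ne',
        Real.logb_rpow (by norm_num) (by norm_num)]
      ring
    have hmono : MonotoneOn (Real.logb 2) (Set.Ioi 0) := fun x hx y _ hxy =>
      Real.logb_le_logb_of_le (by norm_num) hx hxy
    have m1 : 0 < tUX / (tX * tU) := by positivity
    have m2 : 0 < tUY / (tY * tU) * (2 : ℝ) ^ (-(n * R)) := by positivity
    rw [hm, hmono.map_max m1 m2, e1, e2, max_sub_sub_right]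
  have hlog := Real.logb_le_logb_of_le (b := 2) (by norm_num) (by positivity) hp
  rw [Real.logb_div (by positivity) (by positivity), Real.logb_mul (by positivity) (by positivity),
    Real.logb_mul (by positivity) (by positivity), Real.logb_rpow (by norm_num) (by norm_num),
    Real.logb_mul (by positivity) (by positivity), Real.logb_div (by positivity) (by positivity),
    Real.logb_mul (by positivity) (by positivity), Real.logb_mul (by positivity) (by positivity),
    Real.logb_div (by positivity) (by positivity), Real.logb_div (by positivity) (by positivity),
    Real.logb_mul (by positivity) (by positivity), hlogm,
    show (16 : ℝ) = (2 : ℝ) ^ (4 : ℝ) by norm_num, Real.logb_rpow (by norm_num) (by norm_num)]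
    at hlog
  rw [codeExponent, if_neg hp0.ne', EReal.coe_le_coe_iff, one_div (nonExcessProb P d D Φ),
    Real.logb_inv]
  have hmax : max (hUX - hX) (hUY - hY - R) = (1 / (n : ℝ)) *
      max (Real.logb 2 tUX - Real.logb 2 tX) (Real.logb 2 tUY - Real.logb 2 tY - n * R) := by
    rw [mul_max_of_nonneg _ _ (by positivity), eUX, eX, eUY, eY]
    congr 1
    · ring
    · field_simp
  rw [hmax, eL, eZUY, eZUXY, eUY]
  have h9 := mul_le_mul_of_nonneg_left hlog (show 0 ≤ 1 / (n : ℝ) by positivity)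
  linarith

/-- Every feasible distribution yields an asymptotic upper bound on the exponent. -/
lemma eventually_blockExponent_lt [Fintype Z] {P : X × Y → ℝ} (hP : P ∈ stdSimplex ℝ (X × Y))
    (d : X → Y → Z → ℝ) {R D : ℝ} (hR : 0 ≤ R) {Q : Quad X Y Z → ℝ} (hQ : Q ∈ feasible d D)
    {b : EReal} (hb : objective P R Q < b) : ∀ᶠ n in atTop, blockExponent P d R D n < b := by
  have hac : SourceAC P Q := by
    by_contra h
    rw [objective_eq_top R hQ.1.1 h] at hb
    exact not_top_lt hb
  rw [objective_of_sourceAC R hQ.1.1 hac] at hb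
  obtain ⟨k, hk, hlim, hsupp, hcost⟩ :=
    exists_types_tendsto hQ.1 fun ω => d (rvX ω) (rvY ω) (rvZ ω)
  have hkac : ∀ n ω, P (rvX ω, rvY ω) = 0 → k n ω = 0 := fun n ω h => hsupp n ω (hac ω h)
  have hkd : ∀ n, ∑ ω, (k n ω : ℝ) * d (rvX ω) (rvY ω) (rvZ ω) ≤ n * D := fun n =>
    (hcost n).trans (mul_le_mul_of_nonneg_left hQ.2 (Nat.cast_nonneg n))
  have tL : Tendsto (fun n : ℕ => (1 / (n : ℝ)) * ∑ ω, (k n ω : ℝ) *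
      Real.logb 2 (P (rvX ω, rvY ω))) atTop (𝓝 (-crossEntropy P Q rvX rvY)) := by
    rw [crossEntropy, neg_neg]
    refine (tendsto_finsetSum _ fun ω _ =>
      (hlim ω).mul_const (Real.logb 2 (P (rvX ω, rvY ω)))).congr fun n => ?_
    rw [Finset.mul_sum]
    exact Finset.sum_congr rfl fun ω _ => by ring
  have tX := tendsto_logb_card_typeClass_push hk hlim (rvX : Quad X Y Z → X)
  have tY := tendsto_logb_card_typeClass_push hk hlim (rvY : Quad X Y Z → Y)
  have tUX := tendsto_logb_card_typeClass_push hk hlim (fun ω : Quad X Y Z => (rvU ω, rvX ω))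
  have tUY := tendsto_logb_card_typeClass_push hk hlim (fun ω : Quad X Y Z => (rvU ω, rvY ω))
  have tZUY := tendsto_logb_card_typeClass_push hk hlim
    (fun ω : Quad X Y Z => (rvZ ω, rvU ω, rvY ω))
  have tZUXY := tendsto_logb_card_typeClass_push hk hlim
    (fun ω : Quad X Y Z => (rvZ ω, rvU ω, rvX ω, rvY ω))
  have t4 : Tendsto (fun n : ℕ => 4 * (1 / (n : ℝ))) atTop (𝓝 (4 * 0)) :=
    tendsto_one_div_atTop_nhds_zero_nat.const_mul 4
  have t := (t4.add (((tZUY.sub tZUXY).sub tUY).sub tL)).add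
    ((tUX.sub tX).max ((tUY.sub tY).sub_const R))
  have e : entropy Q (fun ω : Quad X Y Z => (rvZ ω, rvU ω, rvX ω, rvY ω)) =
      entropy Q (fun ω => (rvU ω, rvX ω, rvY ω, rvZ ω)) :=
    entropy_congr Q (by simp only [Prod.mk.injEq]; tauto)
  have hval : realObjective P R Q = 4 * 0 + (entropy Q (fun ω => (rvZ ω, rvU ω, rvY ω)) -
      entropy Q (fun ω => (rvZ ω, rvU ω, rvX ω, rvY ω)) - entropy Q (fun ω => (rvU ω, rvY ω)) -
      -crossEntropy P Q rvX rvY) + max (entropy Q (fun ω => (rvU ω, rvX ω)) - entropy Q rvX)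
        (entropy Q (fun ω => (rvU ω, rvY ω)) - entropy Q rvY - R) := by
    rw [e, ← max_add_add_left, realObjective, markovCost, binningCost]
    congr 1 <;> ring
  rw [← hval] at t
  have t' := (continuous_coe_real_ereal.tendsto _).comp t
  filter_upwards [t'.eventually_lt_const hb, eventually_ne_atTop 0] with n h1 hn
  exact (blockExponent_le_of_type hP d hR hn (hk n) (hkac n) (hkd n)
    rfl rfl rfl rfl rfl rfl rfl).trans_lt h1

end Achievability

end

end WynerZiv

theorem theorem1 {X Y Z : Type*} [Fintype X] [Fintype Y] [Fintype Z]
    (P : X × Y → ℝ) (hP : P ∈ stdSimplex ℝ (X × Y))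
    (d : X → Y → Z → ℝ) (hd : ∀ x y z, 0 ≤ d x y z)
    (R D : ℝ) (hR : 0 ≤ R) (hD : 0 ≤ D) :
    -- the limit `F(R, D)` of the optimal exponents exists and equals `F*(R, D)`
    Tendsto (fun n : ℕ => WynerZiv.blockExponent P d R D n) atTop
      (𝓝 (WynerZiv.FStar P d R D)) ∧
    -- the infimum that defines `F*(R, D)` is a minimum
    ((WynerZiv.feasible d D).Nonempty →
      ∃ Q ∈ WynerZiv.feasible d D, WynerZiv.objective P R Q = WynerZiv.FStar P d R D) ∧
    -- the divergence term splits into a source term and the two soft Markov terms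
    (∀ Q ∈ stdSimplex ℝ (WynerZiv.Quad X Y Z),
      WynerZiv.divergence Q (WynerZiv.markovProduct P Q) =
        WynerZiv.divergence
            (WynerZiv.law Q (fun ω => (WynerZiv.rvX ω, WynerZiv.rvY ω))) P
          + ((WynerZiv.condMutualInfo Q WynerZiv.rvU WynerZiv.rvY WynerZiv.rvX : ℝ) : EReal)
          + ((WynerZiv.condMutualInfo Q WynerZiv.rvZ WynerZiv.rvX
              (fun ω => (WynerZiv.rvU ω, WynerZiv.rvY ω)) : ℝ) : EReal)) := by
  refine ⟨?_, WynerZiv.exists_objective_eq_FStar P d R D,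
    fun Q hQ => WynerZiv.divergence_markovProduct_decomposition P hQ.1⟩
  rw [tendsto_order]
  constructor
  · intro a ha
    filter_upwards [eventually_ne_atTop 0] with n hn
    exact ha.trans_le (WynerZiv.FStar_le_blockExponent hP d R D hn)
  · intro b hb
    obtain ⟨Q, hQ⟩ := iInf_lt_iff.1 hb
    obtain ⟨hQ, hlt⟩ := iInf_lt_iff.1 hQ
    exact WynerZiv.eventually_blockExponent_lt hP d hR hQ hlt
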